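/- Let $G$ be a compact Lie group and $E\xrightarrow{p}M$ a smooth real or complex $G$-vector bundle with fibre $V$ (finite rank) over a Hausdorff smooth manifold $M$: $G$ acts smoothly on $M$ and on $E$, by vector bundle isomorphisms. Assume that every isotropy group $G_x$, $x\in M$, is finite, and that the set of $x\in M$ for which $G_x$ acts trivially on the fibre $E_x$ is dense in $M$ (for instance, that the points with trivial isotropy group are dense). Then $\bar p:E/G\to M/G$ is a vector orbibundle with fibre $V$, an atlas being given by all vector orbibundle charts that come from slices: for $x\in M$, take a slice $U$ at $x$, identified with an open neighbourhood of $0$ in $\mathbb R^{\dim M-\dim G}$, so that $G\times_{G_x}U$ is equivariantly diffeomorphic to a neighbourhood of $Gx$, and a trivialization $E|_U\cong U\times V$; the chart is $(U,V,\Gamma,U/\Gamma,\Pi,\pi)$, where $\pi:U\to M/G$ and $\Pi:U\times V\cong E|_U\to E/G$ are the projections and $\Gamma$ is the quotient of $G_x$ by the subgroup acting trivially on $U$. Moreover, the canonical map $$\{f\in C^\infty(M;E) : f \text{ is } G\text{-invariant}\}\longrightarrow C^\infty(M/G;E/G),\qquad f\mapsto \bar f,\quad \bar f(Gx)=G f(x),$$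 is a bijection from the $G$-invariant smooth sections of $E\to M$ onto the smooth sections of the orbibundle $E/G\to M/G$. Here an orbifold chart $(\tilde U,\Gamma,U,\pi)$ consists of an open subset $\tilde U$ of a Euclidean space, a finite group $\Gamma$ acting smoothly and faithfully on $\tilde U$, and a map $\pi$ inducing a homeomorphism from $\tilde U/\Gamma$ onto the open set $U$. A vector orbibundle chart $(\tilde U,V,\Gamma,U,\Pi,\pi)$ of $\bar p$ consists of orbifold charts $(\tilde U,\Gamma,U,\pi)$ of the base and $(\tilde U\times V,\Gamma,\bar p^{-1}(U),\Pi)$ of the total space with $\bar p\,\Pi=\pi\,\mathrm{pr}_1$, $\Gamma$ acting on $\tilde U\times V\to\tilde U$ by vector bundle isomorphisms. Two charts are compatible if any two points $\tilde x_1,\tilde x_2$ of their domains over the same point have neighbourhoods related by a (vector bundle) diffeomorphism commuting with the projections. A map between orbifolds is smooth if it is continuous and, around each point, lifts to a smooth map between the domains of some charts of the maximal atlases; a smooth section of $\bar p$ is a map $s:M/G\to E/G$ with $\bar p\circ s=\mathrm{id}$ that is smooth as a map of orbifolds. -/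

import Mathlib

open Set Function Topology Bundle
open scoped Manifold ContDiff

universe u

namespace Orbifold

section Charts

variable {F : Type*} [NormedAddCommGroup F] [NormedSpace ℝ F]
  {F' : Type*} [NormedAddCommGroup F'] [NormedSpace ℝ F']
  {X : Type*} [TopologicalSpace X] {Y : Type*} [TopologicalSpace Y]

/-- Data for an orbifold chart on `X` modelled on the normed space `F`: a set `source ⊆ F`, a group
`Γ`, maps `act γ` (meaningful on `source`), a set `target ⊆ X` and a projection `proj` (meaningful
on `source`). The axioms are in `IsOrbifoldChart`. -/
structure ChartData (F : Type*) (X : Type*) where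
  source : Set F
  Γ : Type u
  [group : Group Γ]
  act : Γ → F → F
  target : Set X
  proj : F → X

attribute [instance] ChartData.group

/-- `R` is an orbifold chart: the finite group `Γ` acts smoothly and faithfully on the open set
`source`, and `proj` induces a homeomorphism from the orbit space `source / Γ` onto the open set
`target`. The last condition is spelled out in the fields `continuousOn`, `image`, `fiber` and
`isOpen_image` (the quotient map onto an orbit space is always open). -/
structure IsOrbifoldChart (R : ChartData.{u} F X) : Prop where
  finite : Finite R.Γ
  isOpen_source : IsOpen R.source
  isOpen_target : IsOpen R.target
  mapsTo : ∀ γ, MapsTo (R.act γ) R.source R.source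
  one_act : ∀ z ∈ R.source, R.act 1 z = z
  mul_act : ∀ γ γ', ∀ z ∈ R.source, R.act (γ * γ') z = R.act γ (R.act γ' z)
  smooth : ∀ γ, ContDiffOn ℝ ∞ (R.act γ) R.source
  faithful : ∀ γ, (∀ z ∈ R.source, R.act γ z = z) → γ = 1
  continuousOn : ContinuousOn R.proj R.source
  image : R.proj '' R.source = R.target
  fiber : ∀ z ∈ R.source, ∀ w ∈ R.source, R.proj z = R.proj w ↔ ∃ γ, R.act γ z = w
  isOpen_image : ∀ W ⊆ R.source, IsOpen W → IsOpen (R.proj '' W)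

/-- A diffeomorphism between open subsets (the source and the target) of two normed spaces. -/
def IsDiffeo (h : OpenPartialHomeomorph F F') : Prop :=
  ContDiffOn ℝ ∞ h h.source ∧ ContDiffOn ℝ ∞ h.symm h.target

/-- Compatibility of orbifold charts: any two points over the same point have neighbourhoods
related by a diffeomorphism which commutes with the projections. -/
def Compatible (R₁ R₂ : ChartData.{u} F X) : Prop :=
  ∀ z₁ ∈ R₁.source, ∀ z₂ ∈ R₂.source, R₁.proj z₁ = R₂.proj z₂ →
    ∃ h : OpenPartialHomeomorph F F, IsDiffeo h ∧
      z₁ ∈ h.source ∧ h z₁ = z₂ ∧ h.source ⊆ R₁.source ∧ h.target ⊆ R₂.source ∧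
      ∀ z ∈ h.source, R₂.proj (h z) = R₁.proj z

/-- The maximal orbifold atlas determined by a set `A` of charts: all orbifold charts compatible
with every chart in `A`. -/
def maximalAtlas (A : Set (ChartData.{u} F X)) : Set (ChartData.{u} F X) :=
  {R | IsOrbifoldChart R ∧ ∀ R' ∈ A, Compatible R R'}

/-- Smooth maps between orbifolds, whose structures are given by the maximal atlases `A`, `B`:
continuous maps that around each point lift to a smooth map between the domains of some charts. -/
def IsSmoothMap (A : Set (ChartData.{u} F X)) (B : Set (ChartData.{u} F' Y)) (f : X → Y) : Prop :=
  Continuous f ∧ ∀ x, ∃ R ∈ A, ∃ R' ∈ B, x ∈ R.target ∧ f x ∈ R'.target ∧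
    ∃ lift : F → F', ContDiffOn ℝ ∞ lift R.source ∧ MapsTo lift R.source R'.source ∧
      ∀ z ∈ R.source, R'.proj (lift z) = f (R.proj z)

end Charts

section Orbibundles

variable (𝕜 : Type*) [RCLike 𝕜]
  {F : Type*} [NormedAddCommGroup F] [NormedSpace ℝ F]
  {V : Type*} [NormedAddCommGroup V] [NormedSpace ℝ V] [NormedSpace 𝕜 V]
  {X : Type*} [TopologicalSpace X] {Y : Type*} [TopologicalSpace Y]

/-- Data for a vector orbibundle chart on `p : Y → X`, with fibre `V`: data `toChartData` for a
chart `(source, Γ, target, proj)` on `X`, with maps `actTotal γ` and a projection `projTotal` on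
`source × V`. -/
structure BundleChartData (F V X Y : Type*) extends ChartData.{u} F X where
  actTotal : Γ → F × V → F × V
  projTotal : F × V → Y

/-- The chart on the total space: `(source × V, Γ, p⁻¹(target), projTotal)`. -/
def BundleChartData.total (p : Y → X) (R : BundleChartData.{u} F V X Y) :
    ChartData.{u} (F × V) Y where
  source := R.source ×ˢ univ
  Γ := R.Γ
  act := R.actTotal
  target := p ⁻¹' R.target
  proj := R.projTotal

/-- `R` is a vector orbibundle chart: `R` gives orbifold charts on the base and on the total space,
`Γ` acts on `source × V → source` by vector bundle isomorphisms over its action on `source`, and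
the projections are compatible with `p`. -/
structure IsBundleChart (p : Y → X) (R : BundleChartData.{u} F V X Y) : Prop where
  base : IsOrbifoldChart R.toChartData
  total : IsOrbifoldChart (R.total p)
  act_fst : ∀ γ, ∀ z ∈ R.source, ∀ v, (R.actTotal γ (z, v)).1 = R.act γ z
  act_linear : ∀ γ, ∀ z ∈ R.source, IsLinearMap 𝕜 fun v => (R.actTotal γ (z, v)).2
  comm : ∀ z ∈ R.source, ∀ v, p (R.projTotal (z, v)) = R.proj z

/-- Compatibility of vector orbibundle charts: any two points of the domains over the same point of
`X` have neighbourhoods `W₁`, `W₂` related by a diffeomorphism `h`, covered by a vector bundle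
diffeomorphism `H` from `W₁ × V` to `W₂ × V`, both commuting with the projections. -/
def BundleCompatible (R₁ R₂ : BundleChartData.{u} F V X Y) : Prop :=
  ∀ z₁ ∈ R₁.source, ∀ z₂ ∈ R₂.source, R₁.proj z₁ = R₂.proj z₂ →
    ∃ (h : OpenPartialHomeomorph F F) (H : OpenPartialHomeomorph (F × V) (F × V)),
      IsDiffeo h ∧ IsDiffeo H ∧
      z₁ ∈ h.source ∧ h z₁ = z₂ ∧ h.source ⊆ R₁.source ∧ h.target ⊆ R₂.source ∧
      H.source = h.source ×ˢ univ ∧ H.target = h.target ×ˢ univ ∧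
      (∀ z ∈ h.source, ∀ v, (H (z, v)).1 = h z) ∧
      (∀ z ∈ h.source, IsLinearMap 𝕜 fun v => (H (z, v)).2) ∧
      (∀ z ∈ h.source, R₂.proj (h z) = R₁.proj z) ∧
      ∀ z ∈ h.source, ∀ v, R₂.projTotal (H (z, v)) = R₁.projTotal (z, v)

/-- `A` is a vector orbibundle atlas on the map `p : Y → X`, so that it makes `X` and `Y` orbifolds
and `p` a vector orbibundle with fibre `V`. -/
structure IsBundleAtlas (p : Y → X) (A : Set (BundleChartData.{u} F V X Y)) : Prop where
  t2_base : T2Space X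
  t2_total : T2Space Y
  continuous : Continuous p
  chart : ∀ R ∈ A, IsBundleChart 𝕜 p R
  cover : ∀ x, ∃ R ∈ A, x ∈ R.target
  compatible : ∀ R ∈ A, ∀ R' ∈ A, BundleCompatible 𝕜 R R'

/-- The smooth sections of the vector orbibundle `p : Y → X` with atlas `A`: maps `s : X → Y` with
`p ∘ s = id` that are smooth as maps between the orbifolds `X` and `Y`, whose structures are the
maximal atlases determined by the charts on `X` and on `Y` underlying the charts in `A`. -/
def smoothSections (p : Y → X) (A : Set (BundleChartData.{u} F V X Y)) : Set (X → Y) :=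
  {s | (∀ x, p (s x) = x) ∧
    IsSmoothMap (maximalAtlas ((fun R => R.toChartData) '' A))
      (maximalAtlas ((fun R => R.total p) '' A)) s}

end Orbibundles

section Linear

/-- `G` acts on the total space of `E → M` by isomorphisms of vector bundles over its action
on `M`: each `g` maps `E x` to `E (g • x)` linearly. -/
def ActsLinearly (𝕜 : Type*) [RCLike 𝕜] (G : Type u) [Group G] {M : Type*} [MulAction G M]
    (V : Type*) (E : M → Type*) [∀ x, AddCommGroup (E x)] [∀ x, Module 𝕜 (E x)]
    [MulAction G (TotalSpace V E)] : Prop :=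
  ∀ (g : G) (x : M), ∃ L : E x →ₗ[𝕜] E (g • x),
    ∀ v : E x, g • (⟨x, v⟩ : TotalSpace V E) = ⟨g • x, L v⟩

theorem ActsLinearly.proj_smul {𝕜 : Type*} [RCLike 𝕜] {G : Type u} [Group G] {M : Type*}
    [MulAction G M] {V : Type*} {E : M → Type*} [∀ x, AddCommGroup (E x)] [∀ x, Module 𝕜 (E x)]
    [MulAction G (TotalSpace V E)] (h : ActsLinearly 𝕜 G V E) (g : G) (e : TotalSpace V E) :
    (g • e).proj = g • e.proj := by
  obtain ⟨L, hL⟩ := h g e.proj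
  exact congrArg TotalSpace.proj (hL e.snd)

end Linear

section Quotient

variable (𝕜 : Type*) [RCLike 𝕜] {m q : ℕ}
  (G : Type u) [Group G] [TopologicalSpace G] [ChartedSpace (EuclideanSpace ℝ (Fin q)) G]
  {M : Type*} [TopologicalSpace M] [ChartedSpace (EuclideanSpace ℝ (Fin m)) M] [MulAction G M]
  (V : Type*) [NormedAddCommGroup V] [NormedSpace ℝ V] [NormedSpace 𝕜 V]
  (E : M → Type*) [TopologicalSpace (TotalSpace V E)] [∀ x, TopologicalSpace (E x)]
  [∀ x, AddCommGroup (E x)] [∀ x, Module ℝ (E x)] [∀ x, Module 𝕜 (E x)]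
  [FiberBundle V E] [VectorBundle ℝ V E] [MulAction G (TotalSpace V E)]

variable {𝕜 G V E} in
/-- The map `E / G → M / G` induced by the bundle projection. -/
def orbitProj (h : ActsLinearly 𝕜 G V E) :
    MulAction.orbitRel.Quotient G (TotalSpace V E) → MulAction.orbitRel.Quotient G M :=
  Quotient.map TotalSpace.proj <| by
    rintro _ e ⟨g, rfl⟩
    exact ⟨g, (h.proj_smul g e).symm⟩

/-- The smooth sections `f` of `E → M` with `g · f = f` for all `g`, where
`(g · f) x = g • f (g⁻¹ • x)`. -/
def InvariantSection : Type _ :=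
  {f : ContMDiffSection (𝓡 m) V ∞ E //
    ∀ (g : G) (x : M), g • (⟨g⁻¹ • x, f (g⁻¹ • x)⟩ : TotalSpace V E) = ⟨x, f x⟩}

variable {G V E} in
/-- The map `M / G → E / G`, `G x ↦ G f(x)`, induced by an invariant section `f`. -/
noncomputable def InvariantSection.induced (f : InvariantSection (m := m) G V E) :
    MulAction.orbitRel.Quotient G M → MulAction.orbitRel.Quotient G (TotalSpace V E) :=
  Quotient.map (fun x => (⟨x, f.1 x⟩ : TotalSpace V E)) <| by
    rintro _ x ⟨g, rfl⟩
    refine ⟨g, ?_⟩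
    have key : ∀ y : M, y = x → (⟨y, f.1 y⟩ : TotalSpace V E) = ⟨x, f.1 x⟩ := by
      rintro y rfl
      rfl
    have hg := f.2 g (g • x)
    rwa [key _ (inv_smul_smul g x)] at hg

/-- A slice at `x` for the `G`-vector bundle `E → M`, in coordinates, giving the chart `R` of
`E / G → M / G`. Here `σ` parametrizes a slice at `x` by a neighbourhood `R.source` of `0` in
`ℝ ^ (dim M - dim G)`, and `S` is a trivialization of `E` over the slice. The stabilizer `Gₓ` acts
on `R.source × V` and on `R.source` through the surjection `θ : Gₓ → Γ`, `S` and `σ` are equivariant,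
and `(g, z) ↦ g • σ z` induces an equivariant diffeomorphism from `G ×_{Gₓ} R.source` onto a
neighbourhood of the orbit of `x`. As `Γ` is faithful on `R.source`, it is the quotient of `Gₓ` by
the subgroup acting trivially on the slice. -/
structure IsSlice
    (R : BundleChartData.{u} (EuclideanSpace ℝ (Fin (m - q))) V
      (MulAction.orbitRel.Quotient G M) (MulAction.orbitRel.Quotient G (TotalSpace V E)))
    (x : M) (σ : EuclideanSpace ℝ (Fin (m - q)) → M)
    (S : EuclideanSpace ℝ (Fin (m - q)) × V → TotalSpace V E)
    (θ : MulAction.stabilizer G x →* R.Γ) : Prop where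
  zero_mem : 0 ∈ R.source
  center : σ 0 = x
  smooth : ContMDiffOn (𝓡 (m - q)) (𝓡 m) ∞ σ R.source
  smooth_total : ContMDiffOn (𝓘(ℝ, EuclideanSpace ℝ (Fin (m - q)) × V)) ((𝓡 m).prod 𝓘(ℝ, V)) ∞
    S (R.source ×ˢ univ)
  linear : ∀ z ∈ R.source, ∃ L : V ≃ₗ[𝕜] E (σ z), ∀ v, S (z, v) = ⟨σ z, L v⟩
  surjective : Surjective θ
  equivariant : ∀ g, ∀ z ∈ R.source, σ (R.act (θ g) z) = (g : G) • σ z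
  equivariant_total : ∀ g, ∀ z ∈ R.source, ∀ v, S (R.actTotal (θ g) (z, v)) = (g : G) • S (z, v)
  localDiffeo : IsLocalDiffeomorphOn ((𝓡 q).prod (𝓡 (m - q))) (𝓡 m) ∞
    (fun y : G × EuclideanSpace ℝ (Fin (m - q)) => y.1 • σ y.2) (univ ×ˢ R.source)
  slice : ∀ z ∈ R.source, ∀ w ∈ R.source, ∀ g : G, g • σ z = σ w →
    ∃ hg : g ∈ MulAction.stabilizer G x, R.act (θ ⟨g, hg⟩) z = w
  proj_eq : ∀ z ∈ R.source, R.proj z = Quotient.mk _ (σ z)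
  projTotal_eq : ∀ z ∈ R.source, ∀ v, R.projTotal (z, v) = Quotient.mk _ (S (z, v))

variable {𝕜 G V E} in
/-- The canonical atlas of the vector orbibundle `E / G → M / G`: all vector orbibundle charts that
come from slices of the `G`-vector bundle `E → M`. -/
def canonicalAtlas (h : ActsLinearly 𝕜 G V E) :
    Set (BundleChartData.{u} (EuclideanSpace ℝ (Fin (m - q))) V
      (MulAction.orbitRel.Quotient G M) (MulAction.orbitRel.Quotient G (TotalSpace V E))) :=
  {R | IsBundleChart 𝕜 (orbitProj h) R ∧ ∃ x σ S θ, IsSlice (q := q) 𝕜 G V E R x σ S θ}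

end Quotient

end Orbifold

/-!
Finiteness of the isotropy groups makes `M / G` an orbifold through the slice theorem. An integral
curve argument shows that the orbit maps are immersions (`injective_mfderiv_orbitMap`). Averaging a
chart over the finite group `Gₓ` linearizes its action near `x` (`exists_equivariant_chart`), and a
`Gₓ`-invariant complement of the tangent space of the orbit (`exists_invariant_complement`) is a
transversal `σ` on which `Gₓ` acts linearly. By the inverse function theorem `(g, z) ↦ g • σ z` is a
local diffeomorphism, and compactness of `G` forces elements of `G` that relate two points of a
small transversal to lie in `Gₓ`. This is the slice theorem `exists_slice`. Together with a
trivialization of `E` over the slice, it gives a chart of `E / G → M / G` (`exists_linear_chart`).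
The subgroup of `Gₓ` that acts trivially on the slice must also act trivially on `E` over the slice
for `Γ` to act on the bundle chart. It does so over a dense set of points, because isotropy groups
act trivially on the fibres there, hence everywhere (`smul_eq_of_fixes_transversal`).

Two slices through the same orbit are related by elements of `G` that depend smoothly on the point:
they are read off from the local inverse of `(g, z) ↦ g • σ z`. Transport by these elements gives
the transition maps of the charts, both of the base and of the bundle (`exists_transition`).

An invariant section `f` is read in a chart as `z ↦ (z, f (σ z))`, so the induced map is smooth. It
determines `f`: over a point whose isotropy group acts trivially on the fibre, a vector is
determined by its orbit, and such points are dense (`eqOn_of_mk_eq`). Conversely, consider a smooth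
section `s` of the orbibundle. Transition maps turn the smooth local lifts of `s` into smooth maps
`L` into the bundle chart at `x`, with `L z` over `γ z • z` for some `γ z` in the finite group `Γ`.
The action on the chart is linear, so the derivative of the base component of `L` takes finitely
many values by Baire's theorem and continuity; hence `γ` can be chosen constant
(`exists_eqOn_of_forall_exists_eq`), and `γ⁻¹ • L` is a lift over the identity. Extending it by the
action of `G` gives a smooth section of `E` near `x` inducing `s` (`exists_local_section`). By
uniqueness these local sections agree on overlaps, and their union is invariant
(`exists_induced_eq`).
-/

namespace Orbifold

/-! ### The inverse function theorem on manifolds -/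

section LocalDiffeo

variable {E₁ : Type*} [NormedAddCommGroup E₁] [NormedSpace ℝ E₁]
  {H₁ : Type*} [TopologicalSpace H₁] {I : ModelWithCorners ℝ E₁ H₁}
  {E₂ : Type*} [NormedAddCommGroup E₂] [NormedSpace ℝ E₂]
  {H₂ : Type*} [TopologicalSpace H₂] {J : ModelWithCorners ℝ E₂ H₂}
  {P : Type*} [TopologicalSpace P] [ChartedSpace H₁ P]
  {N : Type*} [TopologicalSpace N] [ChartedSpace H₂ N]

theorem isLocalDiffeomorphAt_congr {f g : P → N} {x : P}
    (hf : IsLocalDiffeomorphAt I J ∞ f x) (h : g =ᶠ[𝓝 x] f) :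
    IsLocalDiffeomorphAt I J ∞ g x := by
  obtain ⟨Φ, hx, hΦ⟩ := hf
  obtain ⟨O, hO, hOo, hxO⟩ := eventually_nhds_iff.1 h
  have hrestr : IsOpen (Φ.target ∩ Φ.symm ⁻¹' O) :=
    Φ.contMDiffOn_invFun.continuousOn.isOpen_inter_preimage Φ.open_target hOo
  refine ⟨{ Φ.toPartialEquiv.restr O with
      open_source := Φ.open_source.inter hOo
      open_target := hrestr
      contMDiffOn_toFun := Φ.contMDiffOn_toFun.mono inter_subset_left
      contMDiffOn_invFun := Φ.contMDiffOn_invFun.mono inter_subset_left }, ⟨hx, hxO⟩, ?_⟩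
  rintro y ⟨hy, hyO⟩
  exact (hO y hyO).trans (hΦ hy)

theorem isLocalDiffeomorphAt_eventually {f : P → N} {x : P}
    (hf : IsLocalDiffeomorphAt I J ∞ f x) :
    ∀ᶠ y in 𝓝 x, IsLocalDiffeomorphAt I J ∞ f y := by
  obtain ⟨Φ, hx, hΦ⟩ := hf
  filter_upwards [Φ.open_source.mem_nhds hx] with y hy
  exact ⟨Φ, hy, hΦ⟩

/-- A local diffeomorphism is injective near the point. -/
theorem isLocalDiffeomorphAt_injOn {f : P → N} {x : P}
    (hf : IsLocalDiffeomorphAt I J ∞ f x) :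
    ∀ᶠ p in 𝓝 (x, x), f p.1 = f p.2 → p.1 = p.2 := by
  obtain ⟨Φ, hx, hΦ⟩ := hf
  filter_upwards [(Φ.open_source.prod Φ.open_source).mem_nhds ⟨hx, hx⟩] with p hp he
  exact Φ.injOn hp.1 hp.2 (by rw [← hΦ hp.1, ← hΦ hp.2]; exact he)

theorem isLocalDiffeomorphAt_of_hasFDerivAt [CompleteSpace E₁] {f : E₁ → E₂} {s : Set E₁}
    (hs : IsOpen s) (hf : ContDiffOn ℝ ∞ f s) {a : E₁} (ha : a ∈ s) (e : E₁ ≃L[ℝ] E₂)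
    (he : HasFDerivAt f (e : E₁ →L[ℝ] E₂) a) :
    IsLocalDiffeomorphAt 𝓘(ℝ, E₁) 𝓘(ℝ, E₂) ∞ f a := by
  have hfa : ContDiffAt ℝ ∞ f a := hf.contDiffAt (hs.mem_nhds ha)
  set Φ := hfa.toOpenPartialHomeomorph f he (by simp) with hΦ
  have hcoe : (Φ : E₁ → E₂) = f := rfl
  have hcont : ContinuousOn (fderiv ℝ f) s := hf.continuousOn_fderiv_of_isOpen hs (by simp)
  -- where the derivative is invertible, the local inverse is smooth
  have hO := hcont.isOpen_inter_preimage hs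
    (ContinuousLinearEquiv.isOpen (𝕜 := ℝ) (E := E₁) (F := E₂))
  set O := s ∩ fderiv ℝ f ⁻¹' range ((↑) : (E₁ ≃L[ℝ] E₂) → E₁ →L[ℝ] E₂)
  have haO : a ∈ O := ⟨ha, e, by rw [he.fderiv]⟩
  set Ψ := Φ.restrOpen O hO
  have hsub : ∀ z ∈ Ψ.source, z ∈ O := fun z hz => by
    rw [OpenPartialHomeomorph.restrOpen_source] at hz
    exact hz.2
  refine ⟨{ Ψ.toPartialEquiv with
      open_source := Ψ.open_source
      open_target := Ψ.open_target
      contMDiffOn_toFun := ?_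
      contMDiffOn_invFun := ?_ }, ?_, fun z hz => rfl⟩
  · exact (hf.mono fun z hz => (hsub z hz).1).contMDiffOn
  · refine ContDiffOn.contMDiffOn fun y hy => ?_
    have hy' : Ψ.symm y ∈ O := hsub _ (Ψ.map_target hy)
    obtain ⟨e', he'⟩ := hy'.2
    refine (Ψ.contDiffAt_symm (f₀' := e') hy ?_ ?_).contDiffWithinAt
    · rw [he']
      exact ((hf.contDiffAt (hs.mem_nhds hy'.1)).differentiableAt (by simp)).hasFDerivAt
    · exact hf.contDiffAt (hs.mem_nhds hy'.1)
  · change a ∈ Ψ.source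
    rw [OpenPartialHomeomorph.restrOpen_source]
    exact ⟨hfa.mem_toOpenPartialHomeomorph_source he (by simp), haO⟩

/-- The inverse function theorem for a map from a manifold without boundary to a vector space. -/
theorem isLocalDiffeomorphAt_of_bijective_mfderiv [I.Boundaryless] [IsManifold I ∞ P]
    [CompleteSpace E₁] [CompleteSpace E₂] {f : P → E₂} {s : Set P} (hs : IsOpen s)
    (hf : ContMDiffOn I 𝓘(ℝ, E₂) ∞ f s) {x : P} (hx : x ∈ s)
    (hbij : Bijective (mfderiv I 𝓘(ℝ, E₂) f x)) :
    IsLocalDiffeomorphAt I 𝓘(ℝ, E₂) ∞ f x := by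
  let χ : PartialDiffeomorph I 𝓘(ℝ, E₁) P E₁ ∞ :=
    { extChartAt I x with
      open_source := isOpen_extChartAt_source x
      open_target := isOpen_extChartAt_target x
      contMDiffOn_toFun := by
        simpa [extChartAt_source] using (contMDiffOn_extChartAt (I := I) (n := ∞) (x := x))
      contMDiffOn_invFun := contMDiffOn_extChartAt_symm x }
  have hχx : x ∈ χ.source := mem_extChartAt_source x
  have hO : IsOpen (χ.target ∩ χ.symm ⁻¹' s) :=
    χ.contMDiffOn_invFun.continuousOn.isOpen_inter_preimage χ.open_target hs
  have hsm : ContDiffOn ℝ ∞ (f ∘ χ.symm) (χ.target ∩ χ.symm ⁻¹' s) :=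
    (hf.comp (χ.contMDiffOn_invFun.mono inter_subset_left) fun z hz => hz.2).contDiffOn
  have hmem : χ x ∈ χ.target ∩ χ.symm ⁻¹' s :=
    ⟨χ.map_source hχx, by change χ.symm (χ x) ∈ s; rwa [show χ.symm (χ x) = x from χ.left_inv hχx]⟩
  have hmd : MDifferentiableAt I 𝓘(ℝ, E₂) f x :=
    (hf.contMDiffAt (hs.mem_nhds hx)).mdifferentiableAt (by simp)
  let D : E₁ →L[ℝ] E₂ := mfderiv I 𝓘(ℝ, E₂) f x
  have hder : HasFDerivAt (f ∘ χ.symm) D (χ x) := by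
    have h : HasFDerivWithinAt (f ∘ χ.symm) D (range I) (χ x) := hmd.hasMFDerivAt.2
    rwa [I.range_eq_univ, hasFDerivWithinAt_univ] at h
  let e : E₁ ≃L[ℝ] E₂ := ContinuousLinearEquiv.ofBijective D
    (LinearMap.ker_eq_bot.2 hbij.1) (LinearMap.range_eq_top.2 hbij.2)
  have h1 := isLocalDiffeomorphAt_of_hasFDerivAt hO hsm hmem e
    (by rw [show (e : E₁ →L[ℝ] E₂) = D from ContinuousLinearEquiv.coe_ofBijective ..]; exact hder)
  have h2 := (χ.isLocalDiffeomorphAt I 𝓘(ℝ, E₁) ∞ hχx).comp 𝓘(ℝ, E₂) E₂ h1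
  refine isLocalDiffeomorphAt_congr h2 ?_
  filter_upwards [χ.open_source.mem_nhds hχx] with y hy
  exact congrArg f (χ.left_inv hy).symm

/-- If `Ψ` and `Ψ ∘ f` are local diffeomorphisms and `f` is continuous, then `f` is a local
diffeomorphism. -/
theorem isLocalDiffeomorphAt_of_comp {E₃ : Type*} [NormedAddCommGroup E₃] [NormedSpace ℝ E₃]
    {H₃ : Type*} [TopologicalSpace H₃] {K : ModelWithCorners ℝ E₃ H₃}
    {Q : Type*} [TopologicalSpace Q] [ChartedSpace H₃ Q] {f : P → N} {Ψ : N → Q} {x : P}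
    (hf : ContinuousAt f x) (hΨ : IsLocalDiffeomorphAt J K ∞ Ψ (f x))
    (hc : IsLocalDiffeomorphAt I K ∞ (Ψ ∘ f) x) : IsLocalDiffeomorphAt I J ∞ f x := by
  refine isLocalDiffeomorphAt_congr (hc.comp J N hΨ.localInverse_isLocalDiffeomorphAt) ?_
  filter_upwards [hf.eventually hΨ.localInverse_eventuallyEq_left] with y hy
  exact hy.symm

end LocalDiffeo

/-! ### Orbit maps with finite stabilizers are immersions -/

section Curves

variable {E₁ : Type*} [NormedAddCommGroup E₁] [NormedSpace ℝ E₁]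
  {H₁ : Type*} [TopologicalSpace H₁] {I : ModelWithCorners ℝ E₁ H₁}
  {P : Type*} [TopologicalSpace P] [ChartedSpace H₁ P]

/-- A curve in a manifold with vanishing derivative is locally constant. -/
theorem eventually_eq_of_hasMFDerivAt_zero [IsManifold I 1 P] {c : ℝ → P} {t₀ : ℝ}
    (h : ∀ᶠ t in 𝓝 t₀, HasMFDerivAt 𝓘(ℝ, ℝ) I c t 0) : ∀ᶠ t in 𝓝 t₀, c t = c t₀ := by
  have hc : ContinuousAt c t₀ := h.self_of_nhds.continuousAt
  have hs := hc.eventually_mem (chart_source_mem_nhds H₁ (c t₀))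
  obtain ⟨ε, hε, hball⟩ := Metric.eventually_nhds_iff_ball.1 (h.and hs)
  have hder : ∀ t ∈ Metric.ball t₀ ε, HasFDerivAt (extChartAt I (c t₀) ∘ c) (0 : ℝ →L[ℝ] E₁) t := by
    intro t ht
    have h1 := (hasMFDerivAt_extChartAt (I := I) (hball t ht).2).comp t (hball t ht).1
    have h2 : HasMFDerivAt 𝓘(ℝ, ℝ) 𝓘(ℝ, E₁) (extChartAt I (c t₀) ∘ c) t (0 : ℝ →L[ℝ] E₁) := by
      refine h1.congr_mfderiv ?_
      exact ContinuousLinearMap.comp_zero _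
    exact h2.hasFDerivAt
  filter_upwards [Metric.ball_mem_nhds t₀ hε] with t ht
  have h0 := Metric.mem_ball_self (x := t₀) hε
  have hcst := Metric.isOpen_ball.is_const_of_fderiv_eq_zero (𝕜 := ℝ)
    (convex_ball t₀ ε).isPreconnected
    (fun s hs => (hder s hs).differentiableAt.differentiableWithinAt)
    (fun s hs => (hder s hs).fderiv) ht h0
  exact (extChartAt I (c t₀)).injOn (by rw [extChartAt_source]; exact (hball t ht).2)
    (mem_extChartAt_source _) hcst

end Curves

section Orbit

variable {E₁ : Type*} [NormedAddCommGroup E₁] [NormedSpace ℝ E₁] [CompleteSpace E₁]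
  {H₁ : Type*} [TopologicalSpace H₁] {I : ModelWithCorners ℝ E₁ H₁} [I.Boundaryless]
  {G : Type*} [Group G] [TopologicalSpace G] [ChartedSpace H₁ G] [LieGroup I ∞ G] [T1Space G]
  {E₂ : Type*} [NormedAddCommGroup E₂] [NormedSpace ℝ E₂]
  {H₂ : Type*} [TopologicalSpace H₂] {J : ModelWithCorners ℝ E₂ H₂}
  {M : Type*} [TopologicalSpace M] [ChartedSpace H₂ M] [IsManifold J ∞ M]
  [MulAction G M] [ContMDiffSMul I J ∞ G M]

/-- If the derivative of the orbit map kills `X`, then the integral curve through `1` of the left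
invariant vector field of `X` stays in the stabilizer; as the latter is finite, the curve is
constant. -/
theorem injective_mfderiv_orbitMap (x : M) [Finite (MulAction.stabilizer G x)] :
    Injective (mfderiv I J (fun g : G => g • x) 1) := by
  rw [injective_iff_map_eq_zero]
  intro X hX
  have : LieGroup I (minSmoothness ℝ 3) G := LieGroup.of_le (n := ∞)
    (by rw [minSmoothness_of_isRCLikeNormedField]; exact ENat.LEInfty.out)
  have : IsManifold I 1 G := IsManifold.of_le (n := ∞) (by simp)
  have : IsManifold J 1 M := IsManifold.of_le (n := ∞) (by simp)
  have ho : ContMDiff I J ∞ (fun g : G => g • x) :=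
    (contMDiff_smul (I := I) (I' := J) (n := ∞)).comp (contMDiff_id.prodMk contMDiff_const)
  have homd : MDifferentiable I J (fun g : G => g • x) := ho.mdifferentiable (by simp)
  have hkill : ∀ g : G,
      mfderiv I J (fun g : G => g • x) g (mulInvariantVectorField (I := I) X g) = 0 := by
    intro g
    have h1 : mfderiv I J ((fun b : G => b • x) ∘ (fun b => g * b)) 1 X =
        mfderiv I J (fun g : G => g • x) g (mulInvariantVectorField (I := I) X g) :=
      mfderiv_comp_apply_of_eq (x := (1 : G)) (homd g)
        ((contMDiff_mul_left (I := I) (n := ∞) (a := g)).mdifferentiable (by simp) 1) (mul_one g) X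
    have h2 : ((fun b : G => b • x) ∘ (fun b => g * b)) =
        (fun y : M => g • y) ∘ (fun b : G => b • x) := by
      ext b
      simp [mul_smul]
    have hg : MDifferentiable J J (fun y : M => g • y) :=
      (ContMDiffSMul.contMDiff_const_smul (I := I) (I' := J) (n := ∞) g).mdifferentiable (by simp)
    rw [← h1, h2, mfderiv_comp_apply _ (hg _) (homd 1), hX]
    exact map_zero _
  obtain ⟨γ, hγ0, hγ⟩ := exists_isMIntegralCurveAt_of_contMDiffAt_boundaryless (t₀ := 0)
    (I := I) (v := mulInvariantVectorField (I := I) X) (x₀ := (1 : G))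
    ((contMDiffAt_mulInvariantVectorField X).of_le (by simp))
  have hconst : ∀ᶠ t in 𝓝 (0 : ℝ), γ t • x = γ 0 • x := by
    refine eventually_eq_of_hasMFDerivAt_zero (I := J) (c := fun t => γ t • x) ?_
    filter_upwards [hγ] with t ht
    refine ((homd (γ t)).hasMFDerivAt.comp t ht).congr_mfderiv ?_
    ext
    change mfderiv I J (fun g : G => g • x) (γ t)
      ((1 : ℝ) • mulInvariantVectorField (I := I) X (γ t)) = 0
    rw [one_smul]
    exact hkill (γ t)
  have hfix : ∀ᶠ t in 𝓝 (0 : ℝ), γ t = 1 := by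
    have hc : ContinuousAt γ 0 := hγ.self_of_nhds.continuousAt
    have hfin : (((MulAction.stabilizer G x : Set G)) \ {1}).Finite := (Set.toFinite _).sdiff
    have hnear : ∀ᶠ t in 𝓝 (0 : ℝ), γ t ∈ (((MulAction.stabilizer G x : Set G)) \ {1})ᶜ :=
      hc.eventually_mem (hfin.isClosed.isOpen_compl.mem_nhds (by rw [hγ0]; simp))
    filter_upwards [hconst, hnear] with t h1 h2
    by_contra h3
    rw [hγ0, one_smul] at h1
    exact h2 ⟨h1, h3⟩
  have hder0 : HasMFDerivAt 𝓘(ℝ, ℝ) I γ 0 (0 : ℝ →L[ℝ] E₁) :=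
    (hasMFDerivAt_const (I := 𝓘(ℝ, ℝ)) (I' := I) (1 : G) (0 : ℝ)).congr_of_eventuallyEq hfix
  have huniq := hasMFDerivAt_unique hγ.self_of_nhds hder0
  have h1 : (1 : ℝ) • mulInvariantVectorField (I := I) X (γ 0) = 0 :=
    congrArg (fun L : ℝ →L[ℝ] E₁ => L 1) huniq
  rw [one_smul, hγ0] at h1
  -- the value of the invariant field at `1` is defined as the derivative of `b ↦ 1 * b`
  have hid : ∀ f : G → G, f = id → (mfderiv I I f 1 : E₁ → E₁) X = X := by
    rintro _ rfl
    rw [mfderiv_id]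
    rfl
  exact (hid (fun b => 1 * b) (by ext; simp)).symm.trans h1

end Orbit

/-! ### Linearization of the action of a finite stabilizer -/

section Linearize

set_option linter.unusedSectionVars false

variable {E₁ : Type*} [NormedAddCommGroup E₁] [NormedSpace ℝ E₁]
  {H₁ : Type*} [TopologicalSpace H₁] {I : ModelWithCorners ℝ E₁ H₁}
  {G : Type*} [Group G] [TopologicalSpace G] [ChartedSpace H₁ G]
  {E₂ : Type*} [NormedAddCommGroup E₂] [NormedSpace ℝ E₂]
  {H₂ : Type*} [TopologicalSpace H₂] {J : ModelWithCorners ℝ E₂ H₂} [J.Boundaryless]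
  {M : Type*} [TopologicalSpace M] [ChartedSpace H₂ M] [IsManifold J ∞ M]
  [MulAction G M] [ContMDiffSMul I J ∞ G M]

theorem isLocalDiffeomorphAt_extChartAt (x : M) :
    IsLocalDiffeomorphAt J 𝓘(ℝ, E₂) ∞ (extChartAt J x) x :=
  ⟨{ extChartAt J x with
      open_source := isOpen_extChartAt_source x
      open_target := isOpen_extChartAt_target x
      contMDiffOn_toFun := by
        simpa [extChartAt_source] using (contMDiffOn_extChartAt (I := J) (n := ∞) (x := x))
      contMDiffOn_invFun := contMDiffOn_extChartAt_symm x },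
    mem_extChartAt_source x, fun _ _ => rfl⟩

variable (J) in
/-- The action of `g` read in the preferred chart at `x`. -/
noncomputable def smulInChart (x : M) (g : G) : E₂ → E₂ := fun z =>
  extChartAt J x (g • (extChartAt J x).symm z)

theorem smulInChart_fixed {x : M} {g : G} (hg : g • x = x) :
    smulInChart J x g (extChartAt J x x) = extChartAt J x x := by
  simp [smulInChart, hg]

include I in
theorem contDiffOn_smulInChart (x : M) (g : G) : ContDiffOn ℝ ∞ (smulInChart J x g)
    ((extChartAt J x).target ∩ (extChartAt J x).symm ⁻¹' {y | g • y ∈ (chartAt H₂ x).source}) := by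
  refine ContMDiffOn.contDiffOn ?_
  refine (contMDiffOn_extChartAt (I := J) (n := ∞) (x := x)).comp (t := (chartAt H₂ x).source) ?_
    fun z hz => hz.2
  exact (ContMDiffSMul.contMDiff_const_smul (I := I) (I' := J) (n := ∞) g).comp_contMDiffOn
    ((contMDiffOn_extChartAt_symm x).mono inter_subset_left)

include I in
theorem isOpen_smulInChart_domain (x : M) (g : G) : IsOpen
    ((extChartAt J x).target ∩ (extChartAt J x).symm ⁻¹' {y | g • y ∈ (chartAt H₂ x).source}) := by
  refine (continuousOn_extChartAt_symm x).isOpen_inter_preimage (isOpen_extChartAt_target x) ?_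
  exact (chartAt H₂ x).open_source.preimage
    (ContMDiffSMul.contMDiff_const_smul (I := I) (I' := J) (n := ∞) g).continuous

theorem mem_smulInChart_domain {x : M} {g : G} (hg : g • x = x) : extChartAt J x x ∈
    (extChartAt J x).target ∩ (extChartAt J x).symm ⁻¹' {y | g • y ∈ (chartAt H₂ x).source} := by
  refine ⟨mem_extChartAt_target x, ?_⟩
  simp [hg]

include I in
theorem hasFDerivAt_smulInChart {x : M} {g : G} (hg : g • x = x) :
    HasFDerivAt (smulInChart J x g) (fderiv ℝ (smulInChart J x g) (extChartAt J x x))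
      (extChartAt J x x) :=
  (((contDiffOn_smulInChart (I := I) x g).contDiffAt
    ((isOpen_smulInChart_domain (I := I) x g).mem_nhds
      (mem_smulInChart_domain hg))).differentiableAt (by simp)).hasFDerivAt

variable (I J) in
/-- The isotropy representation: the stabilizer of `x` acts linearly on the model space of `M`,
by the derivatives at `x` of its action read in the preferred chart. -/
noncomputable def isotropyRep (x : M) : MulAction.stabilizer G x →* (E₂ →L[ℝ] E₂) where
  toFun k := fderiv ℝ (smulInChart J x (k : G)) (extChartAt J x x)
  map_one' := by
    have h : smulInChart J x (1 : G) =ᶠ[𝓝 (extChartAt J x x)] id := by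
      filter_upwards [(isOpen_extChartAt_target (I := J) x).mem_nhds (mem_extChartAt_target x)]
        with z hz
      simp only [smulInChart, one_smul, (extChartAt J x).right_inv hz, id]
    exact (h.fderiv_eq (𝕜 := ℝ)).trans fderiv_id
  map_mul' k l := by
    have h : smulInChart J x ((k * l : MulAction.stabilizer G x) : G) =ᶠ[𝓝 (extChartAt J x x)]
        smulInChart J x (k : G) ∘ smulInChart J x (l : G) := by
      filter_upwards [(isOpen_smulInChart_domain (I := I) x (l : G)).mem_nhds
        (mem_smulInChart_domain l.2)] with z hz
      have hz' : (l : G) • (extChartAt J x).symm z ∈ (extChartAt J x).source := by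
        rw [extChartAt_source]
        exact hz.2
      simp only [smulInChart, comp_apply, (extChartAt J x).left_inv hz', Subgroup.coe_mul, mul_smul]
    have hk : DifferentiableAt ℝ (smulInChart J x (k : G))
        (smulInChart J x (l : G) (extChartAt J x x)) := by
      rw [smulInChart_fixed l.2]
      exact (hasFDerivAt_smulInChart (I := I) k.2).differentiableAt
    rw [h.fderiv_eq (𝕜 := ℝ),
      fderiv_comp _ hk (hasFDerivAt_smulInChart (I := I) l.2).differentiableAt,
      smulInChart_fixed l.2]
    rfl

theorem hasFDerivAt_smulInChart_isotropyRep {x : M} (k : MulAction.stabilizer G x) :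
    HasFDerivAt (smulInChart J x (k : G)) (isotropyRep I J x k) (extChartAt J x x) :=
  hasFDerivAt_smulInChart (I := I) k.2

variable (I J) in
/-- Bochner's linearization: the average over the stabilizer of the conjugates of the preferred
chart at `x` is an equivariant chart at `x`. -/
theorem exists_equivariant_chart [CompleteSpace E₂] (x : M) [Finite (MulAction.stabilizer G x)] :
    ∃ Ψ : M → E₂, Ψ x = 0 ∧
      (∀ (k : MulAction.stabilizer G x) (y : M), Ψ ((k : G) • y) = isotropyRep I J x k (Ψ y)) ∧
      IsLocalDiffeomorphAt J 𝓘(ℝ, E₂) ∞ Ψ x := by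
  have := Fintype.ofFinite (MulAction.stabilizer G x)
  set A := isotropyRep I J (G := G) x with hA
  set c : ℝ := (Fintype.card (MulAction.stabilizer G x) : ℝ)⁻¹ with hc
  set Ψ : M → E₂ := fun y => c • ∑ k : MulAction.stabilizer G x,
    A k⁻¹ (extChartAt J x ((k : G) • y) - extChartAt J x x) with hΨ
  refine ⟨Ψ, ?_, ?_, ?_⟩
  · have : ∀ k : MulAction.stabilizer G x, (k : G) • x = x := fun k => k.2
    simp [hΨ, this]
  · intro k y
    simp only [hΨ, map_smul, map_sum]
    congr 1
    refine Fintype.sum_equiv (Equiv.mulRight k) _ _ fun l => ?_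
    rw [← mul_apply_eq_comp, ← map_mul]
    simp [mul_smul]
  · set O : Set E₂ := ⋂ k : MulAction.stabilizer G x, ((extChartAt J x).target ∩
      (extChartAt J x).symm ⁻¹' {y | (k : G) • y ∈ (chartAt H₂ x).source}) with hO
    have hOo : IsOpen O := isOpen_iInter_of_finite fun k =>
      isOpen_smulInChart_domain (I := I) x (k : G)
    have hsm : ContDiffOn ℝ ∞ (fun z => Ψ ((extChartAt J x).symm z)) O := by
      refine contDiffOn_const.smul (ContDiffOn.sum fun k _ => ?_)
      exact (A k⁻¹).contDiff.comp_contDiffOn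
        (((contDiffOn_smulInChart (I := I) x (k : G)).mono (iInter_subset _ k)).sub
          contDiffOn_const)
    have hder : HasFDerivAt (fun z => Ψ ((extChartAt J x).symm z))
        ((ContinuousLinearEquiv.refl ℝ E₂ : E₂ ≃L[ℝ] E₂) : E₂ →L[ℝ] E₂) (extChartAt J x x) := by
      have h1 : HasFDerivAt (fun z => Ψ ((extChartAt J x).symm z))
          (c • ∑ k : MulAction.stabilizer G x, (A k⁻¹).comp (A k)) (extChartAt J x x) := by
        refine (HasFDerivAt.fun_sum fun k _ => ?_).const_smul c
        exact (A k⁻¹).hasFDerivAt.comp _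
          ((hasFDerivAt_smulInChart_isotropyRep (I := I) k).sub_const _)
      convert h1 using 1
      have h2 : ∀ k : MulAction.stabilizer G x, (A k⁻¹).comp (A k) = 1 := fun k => by
        rw [← ContinuousLinearMap.mul_def, ← map_mul, inv_mul_cancel, map_one]
      ext v
      simp [h2, hc, ← Nat.cast_smul_eq_nsmul ℝ, smul_smul]
    have hloc := isLocalDiffeomorphAt_of_hasFDerivAt hOo hsm
      (mem_iInter.2 fun k => mem_smulInChart_domain k.2) _ hder
    refine isLocalDiffeomorphAt_congr ((isLocalDiffeomorphAt_extChartAt x).comp _ _ hloc) ?_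
    filter_upwards [(isOpen_extChartAt_source (I := J) x).mem_nhds (mem_extChartAt_source x)]
      with y hy
    simp only [comp_apply, (extChartAt J x).left_inv hy]

end Linearize

/-! ### Equivariant slices -/

/-- Maschke's theorem, in coordinates: the range of an injective linear map `D` that is invariant
under a finite group has an invariant complement, the kernel of an averaged projection. Here the
complement is the range of the equivariant map `ι`. -/
theorem exists_invariant_complement {K : Type*} [Group K] [Finite K]
    {E₁ : Type*} [AddCommGroup E₁] [Module ℝ E₁] [FiniteDimensional ℝ E₁]
    {E₂ : Type*} [NormedAddCommGroup E₂] [NormedSpace ℝ E₂] [FiniteDimensional ℝ E₂]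
    {q m : ℕ} (hq : Module.finrank ℝ E₁ = q) (hm : Module.finrank ℝ E₂ = m)
    (A : K →* (E₂ →L[ℝ] E₂)) (D : E₁ →ₗ[ℝ] E₂) (hD : Injective D)
    (hinv : ∀ k X, ∃ Y, A k (D X) = D Y) :
    ∃ (ρ : K →* (EuclideanSpace ℝ (Fin (m - q)) →L[ℝ] EuclideanSpace ℝ (Fin (m - q))))
      (ι : EuclideanSpace ℝ (Fin (m - q)) →L[ℝ] E₂),
      (∀ k z, ι (ρ k z) = A k (ι z)) ∧
      Bijective (fun p : E₁ × EuclideanSpace ℝ (Fin (m - q)) => D p.1 + ι p.2) := by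
  have := Fintype.ofFinite K
  obtain ⟨P, hP⟩ := D.exists_leftInverse_of_injective (LinearMap.ker_eq_bot.2 hD)
  have hP' : ∀ X, P (D X) = X := fun X => congrArg (fun L => L X) hP
  set c : ℝ := (Fintype.card K : ℝ)⁻¹ with hc
  set pr : E₂ →ₗ[ℝ] E₂ := c • ∑ k : K, (A k : E₂ →ₗ[ℝ] E₂) ∘ₗ D ∘ₗ P ∘ₗ (A k⁻¹ : E₂ →ₗ[ℝ] E₂)
    with hpr
  have hpra : ∀ v, pr v = c • ∑ k : K, A k (D (P (A k⁻¹ v))) := fun v => by simp [hpr]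
  have hAA : ∀ k l v, A k (A l v) = A (k * l) v := fun k l v => by
    rw [map_mul, mul_apply_eq_comp]
  have hequiv : ∀ k v, pr (A k v) = A k (pr v) := by
    intro k v
    simp only [hpra, map_smul, map_sum]
    congr 1
    refine (Fintype.sum_equiv (Equiv.mulLeft k) _ _ fun l => ?_).symm
    simp only [Equiv.coe_mulLeft, hAA, mul_inv_rev, inv_mul_cancel_right]
  have hfix : ∀ X, pr (D X) = D X := by
    intro X
    have h : ∀ k : K, A k (D (P (A k⁻¹ (D X)))) = D X := fun k => by
      obtain ⟨Y, hY⟩ := hinv k⁻¹ X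
      rw [hY, hP', ← hY, hAA]
      simp
    simp [hpra, h, hc, ← Nat.cast_smul_eq_nsmul ℝ, smul_smul]
  have hrange : ∀ v, pr v ∈ LinearMap.range D := by
    intro v
    rw [hpra]
    refine Submodule.smul_mem _ _ (Submodule.sum_mem _ fun k _ => ?_)
    obtain ⟨Y, hY⟩ := hinv k (P (A k⁻¹ v))
    exact ⟨Y, hY.symm⟩
  have hcompl : IsCompl (LinearMap.range D) (LinearMap.ker pr) := by
    refine ⟨?_, ?_⟩
    · rw [Submodule.disjoint_def]
      rintro _ ⟨X, rfl⟩ hX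
      rw [← hfix]
      exact hX
    · rw [codisjoint_iff, eq_top_iff]
      intro v _
      refine Submodule.mem_sup.2 ⟨pr v, hrange v, v - pr v, ?_, by simp⟩
      obtain ⟨X, hX⟩ := hrange v
      rw [LinearMap.mem_ker, map_sub, ← hX, hfix, sub_self]
  -- the complement has dimension `m - q`, and `q ≤ m` since `D` is injective
  have hdim : Module.finrank ℝ (LinearMap.ker pr) = m - q := by
    have h1 := Submodule.finrank_add_eq_of_isCompl hcompl
    rw [LinearMap.finrank_range_of_inj hD, hq, hm] at h1
    omega
  let e : EuclideanSpace ℝ (Fin (m - q)) ≃ₗ[ℝ] LinearMap.ker pr :=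
    LinearEquiv.ofFinrankEq _ _ (by rw [hdim]; simp)
  let ι : EuclideanSpace ℝ (Fin (m - q)) →ₗ[ℝ] E₂ := (LinearMap.ker pr).subtype ∘ₗ e.toLinearMap
  have hι : Injective ι := (Subtype.val_injective).comp e.injective
  have hιker : ∀ z, pr (ι z) = 0 := fun z => (e z).2
  have hsurj : ∀ v, pr v = 0 → ∃ z, ι z = v := fun v hv =>
    ⟨e.symm ⟨v, hv⟩, by simp [ι]⟩
  have hmaps : ∀ k, ∀ v ∈ LinearMap.ker pr, (A k : E₂ →ₗ[ℝ] E₂) v ∈ LinearMap.ker pr := by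
    intro k v hv
    rw [LinearMap.mem_ker] at hv ⊢
    exact (hequiv k v).trans (by rw [hv, map_zero])
  let r : K → EuclideanSpace ℝ (Fin (m - q)) →L[ℝ] EuclideanSpace ℝ (Fin (m - q)) := fun k =>
    LinearMap.toContinuousLinearMap
      (e.symm.toLinearMap ∘ₗ (A k : E₂ →ₗ[ℝ] E₂).restrict (hmaps k) ∘ₗ e.toLinearMap)
  have hr : ∀ k z, ι (r k z) = A k (ι z) := fun k z => by simp [r, ι]
  refine ⟨⟨⟨r, ?_⟩, ?_⟩, LinearMap.toContinuousLinearMap ι, hr, ?_, ?_⟩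
  · ext1 z
    apply hι
    rw [hr]
    simp
  · intro k l
    ext1 z
    apply hι
    change ι (r (k * l) z) = ι (r k (r l z))
    rw [hr, hr, hr, hAA]
  · rintro ⟨X, z⟩ ⟨X', z'⟩ h
    change D X + ι z = D X' + ι z' at h
    have h1 := congrArg pr h
    rw [map_add, map_add, hfix, hfix, hιker, hιker, add_zero, add_zero] at h1
    rw [h1, add_right_inj] at h
    exact Prod.ext (hD h1) (hι h)
  · intro v
    obtain ⟨X, hX⟩ := hrange v
    obtain ⟨z, hz⟩ := hsurj (v - pr v) (by rw [map_sub, ← hX, hfix, sub_self])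
    refine ⟨(X, z), ?_⟩
    change D X + ι z = v
    rw [hX, hz]
    abel

section Slice

set_option linter.unusedSectionVars false

variable {E₁ : Type*} [NormedAddCommGroup E₁] [NormedSpace ℝ E₁] [FiniteDimensional ℝ E₁]
  {H₁ : Type*} [TopologicalSpace H₁] {I : ModelWithCorners ℝ E₁ H₁} [I.Boundaryless]
  {G : Type*} [Group G] [TopologicalSpace G] [ChartedSpace H₁ G] [LieGroup I ∞ G] [T1Space G]
  {E₂ : Type*} [NormedAddCommGroup E₂] [NormedSpace ℝ E₂] [FiniteDimensional ℝ E₂]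
  {H₂ : Type*} [TopologicalSpace H₂] {J : ModelWithCorners ℝ E₂ H₂} [J.Boundaryless]
  {M : Type*} [TopologicalSpace M] [ChartedSpace H₂ M] [IsManifold J ∞ M]
  [MulAction G M] [ContMDiffSMul I J ∞ G M]

variable (I J) in
/-- The derivative at `1` of the orbit map of `x`, read in an equivariant chart at `x`, is injective
and its range is invariant under the isotropy representation: `k` acts on the range through
conjugation by `k` on `G`. -/
theorem orbit_tangent_invariant (x : M) [Finite (MulAction.stabilizer G x)] {Ψ : M → E₂}
    (hequiv : ∀ (k : MulAction.stabilizer G x) (y : M),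
      Ψ ((k : G) • y) = isotropyRep I J x k (Ψ y))
    (hΨ : IsLocalDiffeomorphAt J 𝓘(ℝ, E₂) ∞ Ψ x) :
    Injective (mfderiv I 𝓘(ℝ, E₂) (fun g : G => Ψ (g • x)) 1) ∧
      ∀ (k : MulAction.stabilizer G x) (X : E₁), ∃ Y : E₁,
        isotropyRep I J x k (mfderiv I 𝓘(ℝ, E₂) (fun g : G => Ψ (g • x)) 1 X) =
          mfderiv I 𝓘(ℝ, E₂) (fun g : G => Ψ (g • x)) 1 Y := by
  have : CompleteSpace E₁ := FiniteDimensional.complete ℝ E₁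
  have ho : MDifferentiable I J (fun g : G => g • x) :=
    ((contMDiff_smul (I := I) (I' := J) (n := ∞)).comp
      (contMDiff_id.prodMk contMDiff_const)).mdifferentiable (by simp)
  have hΨd : MDifferentiableAt J 𝓘(ℝ, E₂) Ψ x := hΨ.mdifferentiableAt (by simp)
  have hd : MDifferentiableAt I 𝓘(ℝ, E₂) (fun g : G => Ψ (g • x)) 1 :=
    MDifferentiableAt.comp_of_eq (I' := J) (1 : G) hΨd (ho 1) (one_smul G x)
  refine ⟨?_, fun k X => ?_⟩
  · have h1 : ∀ X, mfderiv I 𝓘(ℝ, E₂) (fun g : G => Ψ (g • x)) 1 X =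
        mfderiv J 𝓘(ℝ, E₂) Ψ x (mfderiv I J (fun g : G => g • x) 1 X) := fun X =>
      mfderiv_comp_apply_of_eq (x := (1 : G)) hΨd (ho 1) (one_smul G x) X
    have h2 : Injective (mfderiv J 𝓘(ℝ, E₂) Ψ x) := by
      have := (hΨ.mfderivToContinuousLinearEquiv (by simp)).injective
      rwa [← ContinuousLinearEquiv.coe_coe, hΨ.mfderivToContinuousLinearEquiv_coe] at this
    intro X X' h
    rw [h1, h1] at h
    exact injective_mfderiv_orbitMap x (h2 h)
  · have hcd : MDifferentiable I I (fun g : G => (k : G) * g * (k : G)⁻¹) :=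
      ((contMDiff_mul_right (I := I) (n := ∞) (a := (k : G)⁻¹)).comp
        (contMDiff_mul_left (I := I) (n := ∞) (a := (k : G)))).mdifferentiable (by simp)
    refine ⟨mfderiv I I (fun g : G => (k : G) * g * (k : G)⁻¹) 1 X, ?_⟩
    refine Eq.trans ?_ (mfderiv_comp_apply_of_eq (x := (1 : G)) hd (hcd 1) (by simp) X)
    have hfun : (fun g : G => Ψ (g • x)) ∘ (fun g : G => (k : G) * g * (k : G)⁻¹) =
        isotropyRep I J x k ∘ (fun g : G => Ψ (g • x)) := by
      ext1 g
      have hk : (k : G)⁻¹ • x = x := (k⁻¹).2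
      simp only [comp_apply, mul_smul, hk, hequiv]
    have hA : MDifferentiable 𝓘(ℝ, E₂) 𝓘(ℝ, E₂) (isotropyRep I J x k) :=
      fun y => (isotropyRep I J x k).differentiableAt.mdifferentiableAt
    refine Eq.trans ?_ (congrArg (fun f => mfderiv I 𝓘(ℝ, E₂) f 1 X) hfun).symm
    refine ((mfderiv_comp_apply (I' := 𝓘(ℝ, E₂)) (1 : G) (hA _) hd X).trans ?_).symm
    rw [mfderiv_eq_fderiv, ContinuousLinearMap.fderiv]
    rfl

variable (I J) in
/-- The germ of a slice at `x`: an equivariant embedding `σ` of a linear representation of the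
stabilizer of `x`, transversal to the orbits. -/
theorem exists_slice_germ (x : M) [Finite (MulAction.stabilizer G x)] {q m : ℕ}
    (hq : Module.finrank ℝ E₁ = q) (hm : Module.finrank ℝ E₂ = m) :
    ∃ (ρ : MulAction.stabilizer G x →*
        (EuclideanSpace ℝ (Fin (m - q)) →L[ℝ] EuclideanSpace ℝ (Fin (m - q))))
      (σ : EuclideanSpace ℝ (Fin (m - q)) → M),
      σ 0 = x ∧ (∀ᶠ z in 𝓝 0, ContMDiffAt (𝓡 (m - q)) J ∞ σ z) ∧
      (∀ᶠ z in 𝓝 0, ∀ k : MulAction.stabilizer G x, σ (ρ k z) = (k : G) • σ z) ∧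
      IsLocalDiffeomorphAt (I.prod (𝓡 (m - q))) J ∞
        (fun y : G × EuclideanSpace ℝ (Fin (m - q)) => y.1 • σ y.2) (1, 0) := by
  have : CompleteSpace E₁ := FiniteDimensional.complete ℝ E₁
  have : CompleteSpace E₂ := FiniteDimensional.complete ℝ E₂
  have : ContinuousSMul G M := ContMDiffSMul.continuousSMul (I := I) (I' := J) ∞
  obtain ⟨Ψ, hΨ0, hequiv, hΨ⟩ := exists_equivariant_chart I J (G := G) x
  obtain ⟨hinj, hinv⟩ := orbit_tangent_invariant I J x hequiv hΨ
  let D : E₁ →L[ℝ] E₂ := mfderiv I 𝓘(ℝ, E₂) (fun g : G => Ψ (g • x)) 1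
  obtain ⟨ρ, ι, hιρ, hbij⟩ := exists_invariant_complement hq hm (isotropyRep I J x)
    (D : E₁ →ₗ[ℝ] E₂) hinj hinv
  obtain ⟨Φ, hxΦ, hΦ⟩ := hΨ
  have hΦx : Φ x = 0 := by rw [← hΦ hxΦ, hΨ0]
  have hΨc : ∀ y ∈ Φ.source, ContMDiffAt J 𝓘(ℝ, E₂) ∞ Ψ y := fun y hy =>
    (Φ.contMDiffOn_toFun.congr hΦ).contMDiffAt (Φ.open_source.mem_nhds hy)
  have hleft : ∀ y ∈ Φ.source, Φ.symm (Ψ y) = y := fun y hy => by rw [hΦ hy]; exact Φ.left_inv hy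
  have hright : ∀ v ∈ Φ.target, Ψ (Φ.symm v) = v := fun v hv => by
    have : Φ.symm v ∈ Φ.source := Φ.map_target hv
    rw [hΦ this]
    exact Φ.right_inv hv
  set σ : EuclideanSpace ℝ (Fin (m - q)) → M := fun z => Φ.symm (ι z) with hσ
  have hσ0 : σ 0 = x := by
    simp only [hσ, map_zero]
    rw [← hΨ0]
    exact hleft x hxΦ
  have htarget : ∀ᶠ z in 𝓝 0, ι z ∈ Φ.target := by
    refine ι.continuous.continuousAt.eventually_mem (Φ.open_target.mem_nhds ?_)
    rw [map_zero, ← hΦx]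
    exact Φ.map_source hxΦ
  have hσs : ∀ᶠ z in 𝓝 0, ContMDiffAt (𝓡 (m - q)) J ∞ σ z := by
    filter_upwards [htarget] with z hz
    exact (Φ.contMDiffOn_invFun.contMDiffAt (Φ.open_target.mem_nhds hz)).comp z
      ι.contDiff.contMDiff.contMDiffAt
  have hσc : ContinuousAt σ 0 := hσs.self_of_nhds.continuousAt
  have hΘc : ContinuousAt (fun y : G × EuclideanSpace ℝ (Fin (m - q)) => y.1 • σ y.2) (1, 0) :=
    continuousAt_fst.smul (hσc.comp_of_eq continuousAt_snd rfl)
  have hΘ0 : (1 : G) • σ 0 = x := by rw [hσ0, one_smul]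
  have hΘs : ∀ᶠ y : G × EuclideanSpace ℝ (Fin (m - q)) in 𝓝 (1, 0),
      ContMDiffAt (I.prod (𝓡 (m - q))) 𝓘(ℝ, E₂) ∞ (fun y => Ψ (y.1 • σ y.2)) y := by
    filter_upwards [hΘc.eventually_mem (Φ.open_source.mem_nhds (by rwa [hΘ0])),
      continuousAt_snd.eventually hσs] with y hy hy'
    refine ContMDiffAt.comp y (hΨc _ hy) ?_
    exact (contMDiff_smul (I := I) (I' := J) (n := ∞)).contMDiffAt.comp y
      (contMDiffAt_fst.prodMk (hy'.comp y contMDiffAt_snd))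
  obtain ⟨O, hO, hOo, hmem⟩ := eventually_nhds_iff.1 hΘs
  refine ⟨ρ, σ, hσ0, hσs, ?_, ?_⟩
  · refine Filter.eventually_all.2 fun k => ?_
    have hk : ContinuousAt (fun z => (k : G) • σ z) 0 := continuousAt_const.smul hσc
    have hk0 : (k : G) • σ 0 = x := by rw [hσ0]; exact k.2
    filter_upwards [htarget, hk.eventually_mem (Φ.open_source.mem_nhds (by rwa [hk0]))]
      with z hz hkz
    rw [← hleft _ hkz, hequiv]
    simp only [hσ]
    rw [hright _ hz, hιρ]
  · refine isLocalDiffeomorphAt_of_comp (K := 𝓘(ℝ, E₂)) (Ψ := Ψ) hΘc ⟨Φ, by rwa [hΘ0], hΦ⟩ ?_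
    have hd := hΘs.self_of_nhds.mdifferentiableAt (by simp)
    refine isLocalDiffeomorphAt_of_bijective_mfderiv hOo
      (fun y hy => (hO y hy).contMDiffWithinAt) hmem ?_
    refine (congrArg Bijective (funext fun p => ?_)).mpr hbij
    have h1 : (fun z => Ψ ((1 : G) • σ z)) =ᶠ[𝓝 0] ι := by
      filter_upwards [htarget] with z hz
      rw [one_smul]
      exact hright _ hz
    refine (mfderiv_prod_eq_add_apply hd).trans ?_
    -- `mfderiv` depends on the value `f 1` through its type, which prevents rewriting `f`
    have h2 : ∀ f : G → E₂, f = (fun g => Ψ (g • x)) → ∀ X : E₁,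
        (mfderiv I 𝓘(ℝ, E₂) f 1 : E₁ → E₂) X = D X := by
      rintro _ rfl X
      rfl
    rw [h1.mfderiv_eq, mfderiv_eq_fderiv, ContinuousLinearMap.fderiv]
    exact congrArg (· + ι p.2) (h2 (fun g => Ψ (g • σ 0)) (by rw [hσ0]) p.1)

end Slice

section SliceNhd

set_option linter.unusedSectionVars false

variable {E₁ : Type*} [NormedAddCommGroup E₁] [NormedSpace ℝ E₁] [FiniteDimensional ℝ E₁]
  {H₁ : Type*} [TopologicalSpace H₁] {I : ModelWithCorners ℝ E₁ H₁} [I.Boundaryless]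
  {G : Type*} [Group G] [TopologicalSpace G] [ChartedSpace H₁ G] [LieGroup I ∞ G] [T1Space G]
  {E₂ : Type*} [NormedAddCommGroup E₂] [NormedSpace ℝ E₂] [FiniteDimensional ℝ E₂]
  {H₂ : Type*} [TopologicalSpace H₂] {J : ModelWithCorners ℝ E₂ H₂} [J.Boundaryless]
  {M : Type*} [TopologicalSpace M] [ChartedSpace H₂ M] [IsManifold J ∞ M]
  [MulAction G M] [ContMDiffSMul I J ∞ G M]
  {F : Type*} [NormedAddCommGroup F] [NormedSpace ℝ F]

/-- Equivariance propagates local invertibility of `(g, z) ↦ g • σ z` along `G`. -/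
theorem isLocalDiffeomorphAt_smul_of_one {σ : F → M} {z : F}
    (h : IsLocalDiffeomorphAt (I.prod 𝓘(ℝ, F)) J ∞ (fun y : G × F => y.1 • σ y.2) (1, z)) (g : G) :
    IsLocalDiffeomorphAt (I.prod 𝓘(ℝ, F)) J ∞ (fun y : G × F => y.1 • σ y.2) (g, z) := by
  let L : Diffeomorph (I.prod 𝓘(ℝ, F)) (I.prod 𝓘(ℝ, F)) (G × F) (G × F) ∞ :=
    (Diffeomorph.smul I I ∞ g⁻¹).prodCongr (Diffeomorph.refl 𝓘(ℝ, F) F ∞)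
  have hL : L (g, z) = (1, z) := Prod.ext (inv_mul_cancel g) rfl
  have h1 := (L.isLocalDiffeomorph (g, z)).comp J M (by rw [hL]; exact h)
  have h2 := h1.comp J M ((Diffeomorph.smul I J ∞ g).isLocalDiffeomorph _)
  refine isLocalDiffeomorphAt_congr h2 (Filter.Eventually.of_forall fun y => ?_)
  change y.1 • σ y.2 = g • ((g⁻¹ * y.1) • σ y.2)
  rw [smul_smul, mul_inv_cancel_left]

/-- Points of a small transversal `σ` are related only by elements of the stabilizer: elements of
`G` near the stabilizer are handled by local injectivity of `(g, z) ↦ g • σ z`, the others by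
compactness of `G`. -/
theorem eventually_mem_stabilizer [CompactSpace G] [T2Space M] {x : M}
    {ρ : MulAction.stabilizer G x →* (F →L[ℝ] F)} {σ : F → M} (hσ0 : σ 0 = x)
    (hσc : ContinuousAt σ 0)
    (hσe : ∀ᶠ z in 𝓝 0, ∀ k : MulAction.stabilizer G x, σ (ρ k z) = (k : G) • σ z)
    (hloc : IsLocalDiffeomorphAt (I.prod 𝓘(ℝ, F)) J ∞ (fun y : G × F => y.1 • σ y.2) (1, 0)) :
    ∀ᶠ p : F × F in 𝓝 (0, 0), ∀ g : G, g • σ p.1 = σ p.2 → g ∈ MulAction.stabilizer G x := by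
  have : ContinuousSMul G M := ContMDiffSMul.continuousSMul (I := I) (I' := J) ∞
  have : IsTopologicalGroup G := topologicalGroup_of_lieGroup I ∞
  suffices h : ∀ᶠ p : F × F in 𝓝 (0, 0), ∀ g ∈ (univ : Set G),
      g • σ p.1 = σ p.2 → g ∈ MulAction.stabilizer G x by
    filter_upwards [h] with p hp g using hp g (mem_univ g)
  refine isCompact_univ.eventually_forall_of_forall_eventually fun g₀ _ => ?_
  have c1 : ContinuousAt (fun p : (F × F) × G => σ p.1.1) ((0, 0), g₀) :=
    hσc.comp_of_eq (continuousAt_fst.comp continuousAt_fst) rfl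
  have c2 : ContinuousAt (fun p : (F × F) × G => σ p.1.2) ((0, 0), g₀) :=
    hσc.comp_of_eq (continuousAt_snd.comp continuousAt_fst) rfl
  by_cases hg₀ : g₀ ∈ MulAction.stabilizer G x
  -- `g • σ z = σ w` means that `(g₀⁻¹ * g, z)` and `(1, ρ g₀⁻¹ w)` have the same image
  · have c3 : ContinuousAt (fun p : (F × F) × G =>
        (((g₀⁻¹ * p.2, p.1.1) : G × F), ((1, ρ (⟨g₀, hg₀⟩⁻¹) p.1.2) : G × F))) ((0, 0), g₀) := by
      fun_prop
    have e1 : ∀ᶠ q : (G × F) × (G × F) in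
        𝓝 (((g₀⁻¹ * g₀, 0) : G × F), ((1, ρ (⟨g₀, hg₀⟩⁻¹) 0) : G × F)),
        q.1.1 • σ q.1.2 = q.2.1 • σ q.2.2 → q.1 = q.2 := by
      rw [inv_mul_cancel, map_zero]
      exact isLocalDiffeomorphAt_injOn hloc
    have c4 : ContinuousAt (fun p : (F × F) × G => p.1.2) ((0, 0), g₀) :=
      continuousAt_snd.comp continuousAt_fst
    filter_upwards [c3.eventually e1, c4.eventually hσe] with p hp hpe he
    have h1 : p.2 = g₀ := by
      have := hp (by
        rw [hpe, mul_smul, he, one_smul]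
        rfl)
      have h2 : g₀⁻¹ * p.2 = 1 := congrArg Prod.fst this
      exact (inv_mul_eq_one.1 h2).symm
    rwa [h1]
  · have hne : g₀ • σ 0 ≠ σ 0 := by
      rw [hσ0]
      exact hg₀
    have c5 : ContinuousAt (fun p : (F × F) × G => p.2 • σ p.1.1) ((0, 0), g₀) :=
      continuousAt_snd.smul c1
    filter_upwards [(c5.ne_iff_eventually_ne c2).1 hne] with p hp he
    exact absurd he hp

variable (I J) in
/-- The slice theorem: every point `x` has arbitrarily small linear slices `U`, on which the
stabilizer of `x` acts by a representation `ρ`. -/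
theorem exists_slice [CompactSpace G] [T2Space M] (x : M) [Finite (MulAction.stabilizer G x)]
    {q m : ℕ} (hq : Module.finrank ℝ E₁ = q) (hm : Module.finrank ℝ E₂ = m) {W : Set M}
    (hW : W ∈ 𝓝 x) :
    ∃ (ρ : MulAction.stabilizer G x →*
        (EuclideanSpace ℝ (Fin (m - q)) →L[ℝ] EuclideanSpace ℝ (Fin (m - q))))
      (σ : EuclideanSpace ℝ (Fin (m - q)) → M) (U : Set (EuclideanSpace ℝ (Fin (m - q)))),
      IsOpen U ∧ 0 ∈ U ∧ (∀ k, MapsTo (ρ k) U U) ∧ σ 0 = x ∧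
      MapsTo σ U W ∧ ContMDiffOn (𝓡 (m - q)) J ∞ σ U ∧
      (∀ z ∈ U, ∀ k : MulAction.stabilizer G x, σ (ρ k z) = (k : G) • σ z) ∧
      IsLocalDiffeomorphOn (I.prod (𝓡 (m - q))) J ∞
        (fun y : G × EuclideanSpace ℝ (Fin (m - q)) => y.1 • σ y.2) (univ ×ˢ U) ∧
      ∀ z ∈ U, ∀ w ∈ U, ∀ g : G, g • σ z = σ w →
        ∃ hg : g ∈ MulAction.stabilizer G x, ρ ⟨g, hg⟩ z = w := by
  obtain ⟨ρ, σ, hσ0, hσs, hσe, hloc⟩ := exists_slice_germ I J (G := G) x hq hm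
  have hσc : ContinuousAt σ 0 := hσs.self_of_nhds.continuousAt
  have hone : Continuous fun z : EuclideanSpace ℝ (Fin (m - q)) => ((1, z) : G × _) :=
    Continuous.prodMk_right 1
  have hone2 : Continuous fun p : EuclideanSpace ℝ (Fin (m - q)) × EuclideanSpace ℝ (Fin (m - q)) =>
      (((1, p.1), (1, p.2)) : (G × _) × (G × _)) := by fun_prop
  have e1 := (hone.tendsto 0).eventually (isLocalDiffeomorphAt_eventually hloc)
  have e2 := (hone2.tendsto (0, 0)).eventually (isLocalDiffeomorphAt_injOn hloc)
  have e3 := eventually_mem_stabilizer hσ0 hσc hσe hloc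
  have e4 := hσc.eventually_mem (by rwa [hσ0])
  have e5 := (e2.and e3)
  rw [nhds_prod_eq] at e5
  obtain ⟨T, hT, hT'⟩ := Filter.mem_prod_same_iff.1 e5
  obtain ⟨ε, hε, hball⟩ := Metric.eventually_nhds_iff_ball.1
    ((((hσs.and hσe).and e1).and e4).and (Filter.eventually_mem_set.2 hT))
  -- the intersection of the translates of a small ball is an invariant neighbourhood of `0`
  refine ⟨ρ, σ, ⋂ k, ρ k ⁻¹' Metric.ball 0 ε, ?_⟩
  have hsub : ∀ z ∈ ⋂ k, ρ k ⁻¹' Metric.ball 0 ε, z ∈ Metric.ball 0 ε := fun z hz => by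
    have := mem_iInter.1 hz 1
    simpa using this
  have hmaps : ∀ k, MapsTo (ρ k) (⋂ k, ρ k ⁻¹' Metric.ball 0 ε) (⋂ k, ρ k ⁻¹' Metric.ball 0 ε) := by
    intro k z hz
    refine mem_iInter.2 fun l => ?_
    have := mem_iInter.1 hz (l * k)
    rwa [mem_preimage, map_mul, mul_apply_eq_comp] at this
  refine ⟨isOpen_iInter_of_finite fun k => Metric.isOpen_ball.preimage (ρ k).continuous,
    mem_iInter.2 fun k => by simp [hε], hmaps, hσ0, fun z hz => (hball z (hsub z hz)).1.2,
    fun z hz => (hball z (hsub z hz)).1.1.1.1.contMDiffWithinAt,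
    fun z hz => (hball z (hsub z hz)).1.1.1.2, ?_, ?_⟩
  · rintro ⟨⟨g, z⟩, -, hz⟩
    exact isLocalDiffeomorphAt_smul_of_one (hball z (hsub z hz)).1.1.2 g
  · intro z hz w hw g hg
    have hstab := (hT' (mk_mem_prod (hball z (hsub z hz)).2 (hball w (hsub w hw)).2)).2 g hg
    refine ⟨hstab, ?_⟩
    have hz' := hmaps ⟨g, hstab⟩ hz
    have h1 := (hT' (mk_mem_prod (hball _ (hsub _ hz')).2 (hball w (hsub w hw)).2)).1
    have h2 : σ (ρ ⟨g, hstab⟩ z) = σ w := by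
      rw [(hball z (hsub z hz)).1.1.1.2 ⟨g, hstab⟩]
      exact hg
    exact congrArg Prod.snd (h1 (by simpa using h2))

end SliceNhd

/-! ### Hausdorff orbit spaces and total spaces -/

/-- The orbit relation is closed, being the image of a closed set under a projection along the
compact space `G`. -/
theorem t2Space_orbitQuotient (G X : Type*) [Group G] [TopologicalSpace G] [CompactSpace G]
    [TopologicalSpace X] [T2Space X] [MulAction G X] [ContinuousSMul G X] :
    T2Space (MulAction.orbitRel.Quotient G X) := by
  refine (t2Space_iff_of_isOpenQuotientMap
    (MulAction.isOpenQuotientMap_quotientMk (Γ := G) (T := X))).2 ?_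
  have hcl : IsClosed {p : G × (X × X) | p.1 • p.2.2 = p.2.1} :=
    isClosed_eq (by fun_prop) (by fun_prop)
  have h := isClosedMap_snd_of_compactSpace _ hcl
  convert h using 1
  ext ⟨y, x⟩
  simp only [mem_ofPred_eq, Quotient.eq, MulAction.orbitRel_apply, MulAction.mem_orbit_iff,
    mem_image, Prod.exists]
  constructor
  · rintro ⟨g, hg⟩
    exact ⟨g, y, x, hg, rfl⟩
  · rintro ⟨g, y', x', hg, h⟩
    cases h
    exact ⟨g, hg⟩

theorem t2Space_totalSpace {B V : Type*} [TopologicalSpace B] [T2Space B] [TopologicalSpace V]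
    [T2Space V] (E : B → Type*) [TopologicalSpace (TotalSpace V E)] [∀ x, TopologicalSpace (E x)]
    [FiberBundle V E] : T2Space (TotalSpace V E) := by
  refine ⟨fun e e' hne => ?_⟩
  by_cases hb : e.proj = e'.proj
  · set t := trivializationAt V E e.proj
    have he : e ∈ t.source := FiberBundle.mem_trivializationAt_proj_source
    have he' : e' ∈ t.source := by
      rw [t.mem_source, ← hb]
      exact FiberBundle.mem_baseSet_trivializationAt' _
    have hte : t e ≠ t e' := fun h => hne (t.injOn he he' h)
    obtain ⟨u, v, hu, hv, heu, hev, huv⟩ := t2_separation hte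
    refine ⟨t.source ∩ t ⁻¹' u, t.source ∩ t ⁻¹' v,
      t.continuousOn.isOpen_inter_preimage t.open_source hu,
      t.continuousOn.isOpen_inter_preimage t.open_source hv, ⟨he, heu⟩, ⟨he', hev⟩, ?_⟩
    exact (huv.preimage t).mono inter_subset_right inter_subset_right
  · exact separated_by_continuous (FiberBundle.continuous_proj V E) hb

/-! ### Vector bundle frames over transversals -/

section Frames

set_option linter.unusedSectionVars false

variable {𝕜 : Type*} [RCLike 𝕜] {m q : ℕ}
  {G : Type u} [Group G] [TopologicalSpace G] [ChartedSpace (EuclideanSpace ℝ (Fin q)) G]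
  {M : Type*} [TopologicalSpace M] [ChartedSpace (EuclideanSpace ℝ (Fin m)) M]
  [IsManifold (𝓡 m) ∞ M]
  {V : Type*} [NormedAddCommGroup V] [NormedSpace ℝ V] [NormedSpace 𝕜 V] [IsScalarTower ℝ 𝕜 V]
  [FiniteDimensional 𝕜 V]
  {E : M → Type*} [TopologicalSpace (TotalSpace V E)] [∀ x, TopologicalSpace (E x)]
  [∀ x, AddCommGroup (E x)] [∀ x, Module ℝ (E x)] [∀ x, Module 𝕜 (E x)]
  [∀ x, IsScalarTower ℝ 𝕜 (E x)]
  [FiberBundle V E] [VectorBundle ℝ V E] [VectorBundle 𝕜 V E] [ContMDiffVectorBundle ∞ V E (𝓡 m)]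
  [MulAction G M] [MulAction G (TotalSpace V E)]
  {F : Type*} [NormedAddCommGroup F] [NormedSpace ℝ F]

/-- `S` is a smooth trivialization of `E`, linear on fibres, along the smooth map `σ` on the open
set `U`. -/
structure IsFrame (𝕜 : Type*) [RCLike 𝕜] (m : ℕ)
    {M : Type*} [TopologicalSpace M] [ChartedSpace (EuclideanSpace ℝ (Fin m)) M]
    {V : Type*} [NormedAddCommGroup V] [NormedSpace ℝ V] [NormedSpace 𝕜 V]
    {E : M → Type*} [TopologicalSpace (TotalSpace V E)] [∀ x, TopologicalSpace (E x)]
    [∀ x, AddCommGroup (E x)] [∀ x, Module 𝕜 (E x)] [FiberBundle V E]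
    {F : Type*} [NormedAddCommGroup F] [NormedSpace ℝ F]
    (U : Set F) (σ : F → M) (S : F × V → TotalSpace V E) : Prop where
  isOpen : IsOpen U
  smooth : ContMDiffOn 𝓘(ℝ, F) (𝓡 m) ∞ σ U
  smooth_total : ContMDiffOn 𝓘(ℝ, F × V) ((𝓡 m).prod 𝓘(ℝ, V)) ∞ S (U ×ˢ univ)
  linear : ∀ z ∈ U, ∃ L : V ≃ₗ[𝕜] E (σ z), ∀ v, S (z, v) = ⟨σ z, L v⟩

/-- The fibre coordinate of `e` in the frame `S` at `z`; a junk value unless `e` lies in the fibre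
over the point of the transversal with parameter `z`. -/
noncomputable def fiberCoord (S : F × V → TotalSpace V E) (z : F) (e : TotalSpace V E) : V :=
  invFun (fun v => S (z, v)) e

namespace IsFrame

variable {U : Set F} {σ : F → M} {S : F × V → TotalSpace V E}

theorem proj (h : IsFrame 𝕜 m U σ S) {z : F} (hz : z ∈ U) (v : V) : (S (z, v)).proj = σ z := by
  obtain ⟨L, hL⟩ := h.linear z hz
  rw [hL]

theorem injective (h : IsFrame 𝕜 m U σ S) {z : F} (hz : z ∈ U) : Injective fun v => S (z, v) := by
  obtain ⟨L, hL⟩ := h.linear z hz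
  intro v w hvw
  simp only [hL] at hvw
  exact L.injective (TotalSpace.mk_injective _ hvw)

theorem apply_fiberCoord (h : IsFrame 𝕜 m U σ S) {z : F} (hz : z ∈ U) {e : TotalSpace V E}
    (he : e.proj = σ z) : S (z, fiberCoord S z e) = e := by
  refine invFun_eq (f := fun v => S (z, v)) ?_
  obtain ⟨L, hL⟩ := h.linear z hz
  obtain ⟨y, e⟩ := e
  change y = σ z at he
  subst he
  exact ⟨L.symm e, by simp [hL]⟩

theorem exists_equiv (h : IsFrame 𝕜 m U σ S) {z : F} (hz : z ∈ U)
    (t : Trivialization V (TotalSpace.proj : TotalSpace V E → M)) [MemTrivializationAtlas t]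
    (ht : σ z ∈ t.baseSet) : ∃ B : V ≃L[ℝ] V, ∀ v, (t (S (z, v))).2 = B v := by
  have : FiniteDimensional ℝ V := FiniteDimensional.trans ℝ 𝕜 V
  obtain ⟨L, hL⟩ := h.linear z hz
  refine ⟨((L.restrictScalars ℝ).trans (t.linearEquivAt ℝ (σ z) ht)).toContinuousLinearEquiv,
    fun v => ?_⟩
  rw [hL]
  rfl

/-- In a local trivialization of `E` the frame is an invertible matrix depending smoothly on `z`,
and the fibre coordinate is obtained by applying its inverse. -/
theorem contDiffAt_fiberCoord (h : IsFrame 𝕜 m U σ S) {Y : Type*} [NormedAddCommGroup Y]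
    [NormedSpace ℝ Y] {y₀ : Y} {z : Y → F} {e : Y → TotalSpace V E} (hz : ContDiffAt ℝ ∞ z y₀)
    (he : ContMDiffAt 𝓘(ℝ, Y) ((𝓡 m).prod 𝓘(ℝ, V)) ∞ e y₀) (hz₀ : z y₀ ∈ U)
    (hez : ∀ᶠ y in 𝓝 y₀, (e y).proj = σ (z y)) :
    ContDiffAt ℝ ∞ (fun y => fiberCoord S (z y) (e y)) y₀ := by
  have : FiniteDimensional ℝ V := FiniteDimensional.trans ℝ 𝕜 V
  have : CompleteSpace V := FiniteDimensional.complete ℝ V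
  set t := trivializationAt V E (σ (z y₀)) with ht
  have hmem : σ (z y₀) ∈ t.baseSet := FiberBundle.mem_baseSet_trivializationAt' _
  set O := U ∩ σ ⁻¹' t.baseSet with hO
  have hOo : IsOpen O := h.smooth.continuousOn.isOpen_inter_preimage h.isOpen t.open_baseSet
  set B : F → V →L[ℝ] V := fun z => fderiv ℝ (fun v => (t (S (z, v))).2) 0 with hB
  have hBe : ∀ z ∈ O, ∃ B' : V ≃L[ℝ] V, B z = B' ∧ ∀ v, (t (S (z, v))).2 = B' v := by
    intro z hz
    obtain ⟨B', hB'⟩ := h.exists_equiv hz.1 t hz.2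
    refine ⟨B', ?_, hB'⟩
    simp only [hB, hB']
    exact B'.fderiv
  have hmaps : MapsTo S (O ×ˢ univ) t.source := by
    rintro ⟨z, v⟩ ⟨hz, -⟩
    rw [t.mem_source, h.proj hz.1]
    exact hz.2
  have hBs : ContDiffOn ℝ ∞ B O := by
    refine contDiffOn_clm_apply.2 fun v => ?_
    have h1 : ContDiffOn ℝ ∞ (fun y => (t (S y)).2) (O ×ˢ univ) :=
      ((t.contMDiffOn_iff hmaps).1
        (h.smooth_total.mono (prod_mono inter_subset_left subset_rfl))).2.contDiffOn
    have h2 : ContDiffOn ℝ ∞ (fun z => (t (S (z, v))).2) O :=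
      h1.comp (contDiffOn_id.prodMk contDiffOn_const) fun z hz => ⟨hz, mem_univ _⟩
    refine h2.congr fun z hz => ?_
    obtain ⟨B', hB', hv⟩ := hBe z hz
    rw [hB', hv]
    rfl
  have hzO : z y₀ ∈ O := ⟨hz₀, hmem⟩
  obtain ⟨B₀, hB₀, -⟩ := hBe _ hzO
  have hinv : ContDiffAt ℝ ∞ (fun y => (B (z y)).inverse) y₀ := by
    have h1 : ContDiffAt ℝ ∞ ContinuousLinearMap.inverse (B (z y₀)) := by
      rw [hB₀]
      exact contDiffAt_map_inverse B₀
    exact h1.comp y₀ ((hBs.contDiffAt (hOo.mem_nhds hzO)).comp y₀ hz)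
  have hsnd : ContDiffAt ℝ ∞ (fun y => (t (e y)).2) y₀ := by
    refine ((t.contMDiffAt_iff ?_).1 he).2.contDiffAt
    rw [t.mem_source, hez.self_of_nhds]
    exact hmem
  refine (hinv.clm_apply hsnd).congr_of_eventuallyEq ?_
  filter_upwards [hez, hz.continuousAt.eventually_mem (hOo.mem_nhds hzO)] with y hy hyO
  obtain ⟨B', hB', hv⟩ := hBe _ hyO
  rw [hB', ContinuousLinearMap.inverse_equiv]
  refine (B'.symm_apply_eq.2 ?_).symm
  rw [← hv, h.apply_fiberCoord hyO.1 hy]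

end IsFrame

theorem isLinearMap_of_mk_eq {y y' : M} {V' : Type*} [AddCommGroup V'] [Module 𝕜 V']
    (N : V' →ₗ[𝕜] E y') (L : V' →ₗ[𝕜] E y) (hN : Injective N) {k : V' → V'}
    (h : ∀ v, (⟨y', N (k v)⟩ : TotalSpace V E) = ⟨y, L v⟩) : IsLinearMap 𝕜 k := by
  obtain rfl : y' = y := congrArg TotalSpace.proj (h 0)
  have h' : ∀ v, N (k v) = L v := fun v => TotalSpace.mk_injective _ (h v)
  exact ⟨fun v w => hN (by simp [h']), fun c v => hN (by simp [h'])⟩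

/-- The fibre component of a map between frames that is induced by an element of `G` is linear. -/
theorem IsFrame.isLinearMap_transition (hlin : ActsLinearly 𝕜 G V E) {F' : Type*}
    [NormedAddCommGroup F'] [NormedSpace ℝ F']
    {U : Set F} {σ : F → M} {S : F × V → TotalSpace V E} (h : IsFrame 𝕜 m U σ S)
    {U' : Set F'} {σ' : F' → M} {S' : F' × V → TotalSpace V E} (h' : IsFrame 𝕜 m U' σ' S')
    {z : F} (hz : z ∈ U) {w : F'} (hw : w ∈ U') {g : G} {k : V → V}
    (hk : ∀ v, g • S' (w, k v) = S (z, v)) : IsLinearMap 𝕜 k := by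
  obtain ⟨L, hL⟩ := h.linear z hz
  obtain ⟨L', hL'⟩ := h'.linear w hw
  obtain ⟨A, hA⟩ := hlin g (σ' w)
  refine isLinearMap_of_mk_eq (E := E) (V := V) (A ∘ₗ L'.toLinearMap) L.toLinearMap ?_
    fun v => ?_
  · have hAi : Injective A := fun e e' he => by
      have h1 : g • (⟨σ' w, e⟩ : TotalSpace V E) = g • ⟨σ' w, e'⟩ := by
        rw [hA, hA, he]
      exact TotalSpace.mk_injective _ (MulAction.injective g h1)
    exact hAi.comp L'.injective
  · have := hk v
    rw [hL, hL', hA] at this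
    exact this

end Frames

/-! ### Compatibility of slices -/

/-- Continuous maps on open sets that are inverse to each other, as a homeomorphism between the
subsets on which both composites are defined. -/
def partialHomeomorphOfInverse {F F' : Type*} [TopologicalSpace F] [TopologicalSpace F']
    {h : F → F'} {k : F' → F} {O : Set F} {O' : Set F'} (hO : IsOpen O) (hO' : IsOpen O')
    (hh : ContinuousOn h O) (hk : ContinuousOn k O') (hkh : ∀ z ∈ O, k (h z) = z)
    (hhk : ∀ w ∈ O', h (k w) = w) :
    OpenPartialHomeomorph F F' where
  toFun := h
  invFun := k
  source := O ∩ h ⁻¹' O'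
  target := O' ∩ k ⁻¹' O
  map_source' z hz := ⟨hz.2, by rw [mem_preimage, hkh z hz.1]; exact hz.1⟩
  map_target' w hw := ⟨hw.2, by rw [mem_preimage, hhk w hw.1]; exact hw.1⟩
  left_inv' z hz := hkh z hz.1
  right_inv' w hw := hhk w hw.1
  open_source := hh.isOpen_inter_preimage hO hO'
  open_target := hk.isOpen_inter_preimage hO' hO
  continuousOn_toFun := hh.mono inter_subset_left
  continuousOn_invFun := hk.mono inter_subset_left

section Transition

set_option linter.unusedSectionVars false

variable {𝕜 : Type*} [RCLike 𝕜] {m q : ℕ}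
  {G : Type u} [Group G] [TopologicalSpace G] [ChartedSpace (EuclideanSpace ℝ (Fin q)) G]
  [LieGroup (𝓡 q) ∞ G]
  {M : Type*} [TopologicalSpace M] [ChartedSpace (EuclideanSpace ℝ (Fin m)) M]
  [IsManifold (𝓡 m) ∞ M]
  {V : Type*} [NormedAddCommGroup V] [NormedSpace ℝ V] [NormedSpace 𝕜 V] [IsScalarTower ℝ 𝕜 V]
  [FiniteDimensional 𝕜 V]
  {E : M → Type*} [TopologicalSpace (TotalSpace V E)] [∀ x, TopologicalSpace (E x)]
  [∀ x, AddCommGroup (E x)] [∀ x, Module ℝ (E x)] [∀ x, Module 𝕜 (E x)]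
  [∀ x, IsScalarTower ℝ 𝕜 (E x)]
  [FiberBundle V E] [VectorBundle ℝ V E] [VectorBundle 𝕜 V E] [ContMDiffVectorBundle ∞ V E (𝓡 m)]
  [MulAction G M] [ContMDiffSMul (𝓡 q) (𝓡 m) ∞ G M]
  [MulAction G (TotalSpace V E)] [ContMDiffSMul (𝓡 q) ((𝓡 m).prod 𝓘(ℝ, V)) ∞ G (TotalSpace V E)]
  {F : Type*} [NormedAddCommGroup F] [NormedSpace ℝ F]

/-- A point of `M` near `g₀ • σ z₀` is `g • σ z` for `g`, `z` depending smoothly on the point. -/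
theorem exists_smooth_coordinates {σ : F → M} {g₀ : G} {z₀ : F}
    (h : IsLocalDiffeomorphAt ((𝓡 q).prod 𝓘(ℝ, F)) (𝓡 m) ∞ (fun y : G × F => y.1 • σ y.2)
      (g₀, z₀)) :
    ∃ p : M → G × F, p (g₀ • σ z₀) = (g₀, z₀) ∧
      ∀ᶠ y in 𝓝 (g₀ • σ z₀), ContMDiffAt (𝓡 m) ((𝓡 q).prod 𝓘(ℝ, F)) ∞ p y ∧
        (p y).1 • σ (p y).2 = y :=
  ⟨h.localInverse, h.localInverse_left_inv h.localInverse_mem_target, by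
    filter_upwards [h.localInverse.open_source.mem_nhds h.localInverse_mem_source] with y hy
    exact ⟨h.localInverse_contMDiffOn.contMDiffAt (h.localInverse.open_source.mem_nhds hy),
      h.localInverse_right_inv hy⟩⟩

/-- Transport from one frame to another by elements `(p z).1` of `G` depending smoothly on `z`. -/
noncomputable def frameTransition (S S' : F × V → TotalSpace V E) (p : F → G × F) (y : F × V) :
    F × V :=
  ((p y.1).2, fiberCoord S' (p y.1).2 ((p y.1).1⁻¹ • S y))

theorem smul_frameTransition (hlin : ActsLinearly 𝕜 G V E) {U U' : Set F} {σ σ' : F → M}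
    {S S' : F × V → TotalSpace V E} (h : IsFrame 𝕜 m U σ S) (h' : IsFrame 𝕜 m U' σ' S')
    {p : F → G × F} {z : F} (hz : z ∈ U) (hp : (p z).1 • σ' (p z).2 = σ z) (hpz : (p z).2 ∈ U')
    (v : V) : (p z).1 • S' (frameTransition S S' p (z, v)) = S (z, v) := by
  have h1 : S' (frameTransition S S' p (z, v)) = (p z).1⁻¹ • S (z, v) := by
    refine h'.apply_fiberCoord hpz ?_
    rw [hlin.proj_smul, h.proj hz, ← hp, inv_smul_smul]
  rw [h1, smul_inv_smul]

theorem contDiffAt_frameTransition (hlin : ActsLinearly 𝕜 G V E) {U U' : Set F} {σ σ' : F → M}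
    {S S' : F × V → TotalSpace V E} (h : IsFrame 𝕜 m U σ S) (h' : IsFrame 𝕜 m U' σ' S')
    {p : F → G × F} {z : F} (hz : z ∈ U) (hpc : ContMDiffAt 𝓘(ℝ, F) ((𝓡 q).prod 𝓘(ℝ, F)) ∞ p z)
    (hp : ∀ᶠ y in 𝓝 z, (p y).1 • σ' (p y).2 = σ y) (hpz : (p z).2 ∈ U') (v : V) :
    ContDiffAt ℝ ∞ (frameTransition S S' p) (z, v) := by
  have hfst : ContMDiffAt 𝓘(ℝ, F × V) 𝓘(ℝ, F) ∞ (Prod.fst : F × V → F) (z, v) :=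
    contDiff_fst.contMDiff.contMDiffAt
  have h1 : ContMDiffAt 𝓘(ℝ, F × V) ((𝓡 q).prod 𝓘(ℝ, F)) ∞ (fun y : F × V => p y.1) (z, v) :=
    ContMDiffAt.comp (z, v) hpc hfst
  have hbase : ContDiffAt ℝ ∞ (fun y : F × V => (p y.1).2) (z, v) := h1.snd.contDiffAt
  have hS : ContMDiffAt 𝓘(ℝ, F × V) ((𝓡 m).prod 𝓘(ℝ, V)) ∞ S (z, v) :=
    h.smooth_total.contMDiffAt ((h.isOpen.prod isOpen_univ).mem_nhds ⟨hz, mem_univ _⟩)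
  refine hbase.prodMk (h'.contDiffAt_fiberCoord hbase ?_ hpz ?_)
  · exact (contMDiff_smul (I := 𝓡 q) (I' := (𝓡 m).prod 𝓘(ℝ, V)) (n := ∞)
      (G := G) (M := TotalSpace V E)).contMDiffAt.comp (z, v) (h1.fst.inv.prodMk hS)
  · filter_upwards [continuousAt_fst.eventually hp, continuousAt_fst.eventually_mem
      (h.isOpen.mem_nhds hz)] with y hy hyU
    have hyp : (S y).proj = σ y.1 := h.proj hyU y.2
    rw [hlin.proj_smul, hyp, ← hy, inv_smul_smul]

/-- Two transversals through the same orbit are related, near points of this orbit, by a vector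
bundle diffeomorphism `H` over a diffeomorphism `h` that moves points only along orbits; at the
base point it is given by the prescribed element `g₀`. -/
theorem exists_transition (hlin : ActsLinearly 𝕜 G V E) {U₁ U₂ : Set F} {σ₁ σ₂ : F → M}
    {S₁ S₂ : F × V → TotalSpace V E} (h₁ : IsFrame 𝕜 m U₁ σ₁ S₁) (h₂ : IsFrame 𝕜 m U₂ σ₂ S₂)
    (hd₁ : IsLocalDiffeomorphOn ((𝓡 q).prod 𝓘(ℝ, F)) (𝓡 m) ∞
      (fun y : G × F => y.1 • σ₁ y.2) (univ ×ˢ U₁))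
    (hd₂ : IsLocalDiffeomorphOn ((𝓡 q).prod 𝓘(ℝ, F)) (𝓡 m) ∞
      (fun y : G × F => y.1 • σ₂ y.2) (univ ×ˢ U₂))
    {z₁ z₂ : F} (hz₁ : z₁ ∈ U₁) (hz₂ : z₂ ∈ U₂) {g₀ : G} (hg₀ : g₀ • σ₂ z₂ = σ₁ z₁) :
    ∃ (h : OpenPartialHomeomorph F F) (H : OpenPartialHomeomorph (F × V) (F × V)),
      IsDiffeo h ∧ IsDiffeo H ∧
      z₁ ∈ h.source ∧ h z₁ = z₂ ∧ h.source ⊆ U₁ ∧ h.target ⊆ U₂ ∧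
      H.source = h.source ×ˢ univ ∧ H.target = h.target ×ˢ univ ∧
      (∀ z ∈ h.source, ∀ v, (H (z, v)).1 = h z) ∧
      (∀ z ∈ h.source, IsLinearMap 𝕜 fun v => (H (z, v)).2) ∧
      (∀ z ∈ h.source, ∃ g : G, g • σ₂ (h z) = σ₁ z ∧ ∀ v, g • S₂ (H (z, v)) = S₁ (z, v)) ∧
      ∀ v, g₀ • S₂ (H (z₁, v)) = S₁ (z₁, v) := by
  have : IsTopologicalGroup G := topologicalGroup_of_lieGroup (𝓡 q) ∞
  have hσ₁ : ∀ z ∈ U₁, ContMDiffAt 𝓘(ℝ, F) (𝓡 m) ∞ σ₁ z := fun z hz =>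
    h₁.smooth.contMDiffAt (h₁.isOpen.mem_nhds hz)
  have hσ₂ : ∀ z ∈ U₂, ContMDiffAt 𝓘(ℝ, F) (𝓡 m) ∞ σ₂ z := fun z hz =>
    h₂.smooth.contMDiffAt (h₂.isOpen.mem_nhds hz)
  have hg₀' : g₀⁻¹ • σ₁ z₁ = σ₂ z₂ := by rw [← hg₀, inv_smul_smul]
  obtain ⟨P, hP₀, hP⟩ := exists_smooth_coordinates (hd₂ ⟨(g₀, z₂), mem_univ _, hz₂⟩)
  obtain ⟨P', hP₀', hP'⟩ := exists_smooth_coordinates (hd₁ ⟨(g₀⁻¹, z₁), mem_univ _, hz₁⟩)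
  rw [hg₀] at hP₀ hP
  rw [hg₀'] at hP₀' hP'
  set p : F → G × F := fun z => P (σ₁ z) with hp
  set p' : F → G × F := fun z => P' (σ₂ z) with hp'
  have hp₀ : p z₁ = (g₀, z₂) := hP₀
  have hp₀' : p' z₂ = (g₀⁻¹, z₁) := hP₀'
  have ep : ∀ᶠ z in 𝓝 z₁, z ∈ U₁ ∧ ContMDiffAt 𝓘(ℝ, F) ((𝓡 q).prod 𝓘(ℝ, F)) ∞ p z ∧
      (p z).1 • σ₂ (p z).2 = σ₁ z := by
    filter_upwards [h₁.isOpen.mem_nhds hz₁, (hσ₁ z₁ hz₁).continuousAt.eventually hP] with z hz hz'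
    exact ⟨hz, hz'.1.comp z (hσ₁ z hz), hz'.2⟩
  have ep' : ∀ᶠ w in 𝓝 z₂, w ∈ U₂ ∧ ContMDiffAt 𝓘(ℝ, F) ((𝓡 q).prod 𝓘(ℝ, F)) ∞ p' w ∧
      (p' w).1 • σ₁ (p' w).2 = σ₂ w := by
    filter_upwards [h₂.isOpen.mem_nhds hz₂, (hσ₂ z₂ hz₂).continuousAt.eventually hP'] with z hz hz'
    exact ⟨hz, hz'.1.comp z (hσ₂ z hz), hz'.2⟩
  clear_value p p'
  have cp : ContinuousAt p z₁ := ep.self_of_nhds.2.1.continuousAt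
  have cp' : ContinuousAt p' z₂ := ep'.self_of_nhds.2.1.continuousAt
  have c2 : ContinuousAt (fun z => (p z).2) z₁ := continuousAt_snd.comp cp
  have c2' : ContinuousAt (fun z => (p' z).2) z₂ := continuousAt_snd.comp cp'
  have t2 : Filter.Tendsto (fun z => (p z).2) (𝓝 z₁) (𝓝 z₂) := by
    have := c2.tendsto
    rwa [hp₀] at this
  have t2' : Filter.Tendsto (fun z => (p' z).2) (𝓝 z₂) (𝓝 z₁) := by
    have := c2'.tendsto
    rwa [hp₀'] at this
  -- going back and forth is the identity, by local injectivity of `(g, z) ↦ g • σ z`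
  have inv : ∀ᶠ z in 𝓝 z₁, ((p z).1 * (p' (p z).2).1, (p' (p z).2).2) = ((1, z) : G × F) := by
    have hc : Filter.Tendsto
        (fun z => (((p z).1 * (p' (p z).2).1, (p' (p z).2).2), ((1, z) : G × F)))
        (𝓝 z₁) (𝓝 (((1, z₁) : G × F), ((1, z₁) : G × F))) := by
      have c3 : ContinuousAt (fun z => p' (p z).2) z₁ :=
        ContinuousAt.comp_of_eq cp' c2 (by rw [hp₀])
      have c4 : ContinuousAt
          (fun z => (((p z).1 * (p' (p z).2).1, (p' (p z).2).2), ((1, z) : G × F)))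
          z₁ :=
        ((cp.fst.mul c3.fst).prodMk c3.snd).prodMk (continuousAt_const.prodMk continuousAt_id)
      have := c4.tendsto
      simpa [hp₀, hp₀'] using this
    filter_upwards [ep, t2.eventually ep',
      hc.eventually (isLocalDiffeomorphAt_injOn (hd₁ ⟨(1, z₁), mem_univ _, hz₁⟩))] with z h1 h2 h3
    exact h3 (by
      rw [mul_smul, h2.2.2, h1.2.2, one_smul])
  have inv' : ∀ᶠ z in 𝓝 z₂, ((p' z).1 * (p (p' z).2).1, (p (p' z).2).2) = ((1, z) : G × F) := by
    have hc : Filter.Tendsto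
        (fun z => (((p' z).1 * (p (p' z).2).1, (p (p' z).2).2), ((1, z) : G × F)))
        (𝓝 z₂) (𝓝 (((1, z₂) : G × F), ((1, z₂) : G × F))) := by
      have c3 : ContinuousAt (fun z => p (p' z).2) z₂ :=
        ContinuousAt.comp_of_eq cp c2' (by rw [hp₀'])
      have c4 : ContinuousAt
          (fun z => (((p' z).1 * (p (p' z).2).1, (p (p' z).2).2), ((1, z) : G × F)))
          z₂ :=
        ((cp'.fst.mul c3.fst).prodMk c3.snd).prodMk (continuousAt_const.prodMk continuousAt_id)
      have := c4.tendsto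
      simpa [hp₀, hp₀'] using this
    filter_upwards [ep', t2'.eventually ep,
      hc.eventually (isLocalDiffeomorphAt_injOn (hd₂ ⟨(1, z₂), mem_univ _, hz₂⟩))] with z h1 h2 h3
    exact h3 (by
      rw [mul_smul, h2.2.2, h1.2.2, one_smul])
  obtain ⟨O, hO, hOo, hzO⟩ := eventually_nhds_iff.1 (ep.and inv)
  obtain ⟨O', hO', hOo', hzO'⟩ := eventually_nhds_iff.1 (ep'.and inv')
  have relO : ∀ z ∈ O, ∀ᶠ y in 𝓝 z, (p y).1 • σ₂ (p y).2 = σ₁ y := fun z hz => by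
    filter_upwards [hOo.mem_nhds hz] with y hy using (hO y hy).1.2.2
  have relO' : ∀ z ∈ O', ∀ᶠ y in 𝓝 z, (p' y).1 • σ₁ (p' y).2 = σ₂ y := fun z hz => by
    filter_upwards [hOo'.mem_nhds hz] with y hy using (hO' y hy).1.2.2
  have smO : ∀ z ∈ O, ContDiffAt ℝ ∞ (fun z => (p z).2) z := fun z hz =>
    (hO z hz).1.2.1.snd.contDiffAt
  have smO' : ∀ z ∈ O', ContDiffAt ℝ ∞ (fun z => (p' z).2) z := fun z hz =>
    (hO' z hz).1.2.1.snd.contDiffAt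
  let h : OpenPartialHomeomorph F F := partialHomeomorphOfInverse (h := fun z => (p z).2)
    (k := fun z => (p' z).2) hOo hOo'
    (fun z hz => (smO z hz).continuousAt.continuousWithinAt)
    (fun z hz => (smO' z hz).continuousAt.continuousWithinAt)
    (fun z hz => congrArg Prod.snd (hO z hz).2) (fun z hz => congrArg Prod.snd (hO' z hz).2)
  have hsrc : ∀ z ∈ h.source, z ∈ O ∧ (p z).2 ∈ O' := fun z hz => hz
  have htgt : ∀ z ∈ h.target, z ∈ O' ∧ (p' z).2 ∈ O := fun z hz => hz
  have key : ∀ z ∈ h.source, ∀ v, (p z).1 • S₂ (frameTransition S₁ S₂ p (z, v)) = S₁ (z, v) :=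
    fun z hz v => smul_frameTransition hlin h₁ h₂ (hO z hz.1).1.1 (hO z hz.1).1.2.2
      (hO' _ hz.2).1.1 v
  have key' : ∀ z ∈ h.target, ∀ v, (p' z).1 • S₁ (frameTransition S₂ S₁ p' (z, v)) = S₂ (z, v) :=
    fun z hz v => smul_frameTransition hlin h₂ h₁ (hO' z hz.1).1.1 (hO' z hz.1).1.2.2
      (hO _ hz.2).1.1 v
  have smH : ∀ y : F × V, y.1 ∈ h.source → ContDiffAt ℝ ∞ (frameTransition S₁ S₂ p) y :=
    fun y hy => contDiffAt_frameTransition hlin h₁ h₂ (hO _ hy.1).1.1 (hO _ hy.1).1.2.1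
      (relO _ hy.1) (hO' _ hy.2).1.1 y.2
  have smH' : ∀ y : F × V, y.1 ∈ h.target → ContDiffAt ℝ ∞ (frameTransition S₂ S₁ p') y :=
    fun y hy => contDiffAt_frameTransition hlin h₂ h₁ (hO' _ hy.1).1.1 (hO' _ hy.1).1.2.1
      (relO' _ hy.1) (hO _ hy.2).1.1 y.2
  let H : OpenPartialHomeomorph (F × V) (F × V) :=
    { toFun := frameTransition S₁ S₂ p
      invFun := frameTransition S₂ S₁ p'
      source := h.source ×ˢ univ
      target := h.target ×ˢ univ
      map_source' := fun y hy => ⟨h.map_source hy.1, mem_univ _⟩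
      map_target' := fun y hy => ⟨h.map_target hy.1, mem_univ _⟩
      left_inv' := by
        rintro ⟨z, v⟩ ⟨hz, -⟩
        have hfst : (p' (p z).2).2 = z := h.left_inv hz
        refine Prod.ext hfst (h₁.injective (hO z hz.1).1.1 ?_)
        have e1 := key' _ (h.map_source hz) (frameTransition S₁ S₂ p (z, v)).2
        have e2 := key z hz v
        have e3 : (p z).1 * (p' (p z).2).1 = 1 := congrArg Prod.fst (hO z hz.1).2
        have e4 : (z, (frameTransition S₂ S₁ p' (frameTransition S₁ S₂ p (z, v))).2) =
            frameTransition S₂ S₁ p' (frameTransition S₁ S₂ p (z, v)) := Prod.ext hfst.symm rfl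
        change S₁ (z, (frameTransition S₂ S₁ p' (frameTransition S₁ S₂ p (z, v))).2) = S₁ (z, v)
        rw [e4, ← e2]
        refine Eq.trans ?_ (congrArg (fun e => (p z).1 • e) e1)
        rw [smul_smul]
        exact ((congrArg (fun g : G => g • S₁ _) e3).trans (one_smul G _)).symm
      right_inv' := by
        rintro ⟨z, v⟩ ⟨hz, -⟩
        have hfst : (p (p' z).2).2 = z := h.right_inv hz
        refine Prod.ext hfst (h₂.injective (hO' z hz.1).1.1 ?_)
        have e1 := key _ (h.map_target hz) (frameTransition S₂ S₁ p' (z, v)).2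
        have e2 := key' z hz v
        have e3 : (p' z).1 * (p (p' z).2).1 = 1 := congrArg Prod.fst (hO' z hz.1).2
        have e4 : (z, (frameTransition S₁ S₂ p (frameTransition S₂ S₁ p' (z, v))).2) =
            frameTransition S₁ S₂ p (frameTransition S₂ S₁ p' (z, v)) := Prod.ext hfst.symm rfl
        change S₂ (z, (frameTransition S₁ S₂ p (frameTransition S₂ S₁ p' (z, v))).2) = S₂ (z, v)
        rw [e4, ← e2]
        refine Eq.trans ?_ (congrArg (fun e => (p' z).1 • e) e1)
        rw [smul_smul]
        exact ((congrArg (fun g : G => g • S₂ _) e3).trans (one_smul G _)).symm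
      open_source := h.open_source.prod isOpen_univ
      open_target := h.open_target.prod isOpen_univ
      continuousOn_toFun := fun y hy => (smH y hy.1).continuousAt.continuousWithinAt
      continuousOn_invFun := fun y hy => (smH' y hy.1).continuousAt.continuousWithinAt }
  have hz₁h : z₁ ∈ h.source := ⟨hzO, by rw [mem_preimage, hp₀]; exact hzO'⟩
  refine ⟨h, H,
    ⟨fun z hz => (smO z hz.1).contDiffWithinAt, fun z hz => (smO' z hz.1).contDiffWithinAt⟩,
    ⟨fun y hy => (smH y hy.1).contDiffWithinAt, fun y hy => (smH' y hy.1).contDiffWithinAt⟩,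
    hz₁h, congrArg Prod.snd hp₀, fun z hz => (hO z hz.1).1.1, fun z hz => (hO' z hz.1).1.1,
    rfl, rfl, fun z _ v => rfl, ?_, fun z hz => ⟨(p z).1, (hO z hz.1).1.2.2, key z hz⟩, ?_⟩
  · intro z hz
    exact h₁.isLinearMap_transition hlin h₂ (hO z hz.1).1.1 (hO' _ hz.2).1.1 (key z hz)
  · intro v
    have := key z₁ hz₁h v
    rwa [hp₀] at this

end Transition

/-! ### Orbibundle charts from linear slices -/

section OpenImages

variable {E₁ : Type*} [NormedAddCommGroup E₁] [NormedSpace ℝ E₁]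
  {H₁ : Type*} [TopologicalSpace H₁] {I : ModelWithCorners ℝ E₁ H₁}
  {E₂ : Type*} [NormedAddCommGroup E₂] [NormedSpace ℝ E₂]
  {H₂ : Type*} [TopologicalSpace H₂] {J : ModelWithCorners ℝ E₂ H₂}
  {P : Type*} [TopologicalSpace P] [ChartedSpace H₁ P]
  {N : Type*} [TopologicalSpace N] [ChartedSpace H₂ N]

theorem isLocalDiffeomorphAt_image_mem_nhds {f : P → N} {x : P} {s : Set P}
    (hf : IsLocalDiffeomorphAt I J ∞ f x) (hs : s ∈ 𝓝 x) : f '' s ∈ 𝓝 (f x) := by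
  have hc : Filter.Tendsto hf.localInverse (𝓝 (f x)) (𝓝 x) := by
    have h := hf.localInverse_contMDiffAt.continuousAt.tendsto
    rwa [hf.localInverse_left_inv hf.localInverse_mem_target] at h
  filter_upwards [hc hs, hf.localInverse_eventuallyEq_right] with y hy hy'
  exact ⟨_, hy, hy'⟩

end OpenImages

/-- The faithful representation of the quotient of `K` by the kernel of `ρ`. -/
def effectiveRep {K F : Type*} [Group K] [NormedAddCommGroup F] [NormedSpace ℝ F]
    (ρ : K →* (F →L[ℝ] F)) : K ⧸ ρ.ker →* (F →L[ℝ] F) :=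
  QuotientGroup.lift ρ.ker ρ le_rfl

theorem effectiveRep_injective {K F : Type*} [Group K] [NormedAddCommGroup F] [NormedSpace ℝ F]
    (ρ : K →* (F →L[ℝ] F)) {γ : K ⧸ ρ.ker} (h : effectiveRep ρ γ = 1) : γ = 1 := by
  induction γ using QuotientGroup.induction_on with
  | H k => exact (QuotientGroup.eq_one_iff k).2 h

section Charts

set_option linter.unusedSectionVars false

variable {𝕜 : Type*} [RCLike 𝕜] {m q : ℕ}
  {G : Type u} [Group G] [TopologicalSpace G] [ChartedSpace (EuclideanSpace ℝ (Fin q)) G]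
  [LieGroup (𝓡 q) ∞ G]
  {M : Type*} [TopologicalSpace M] [ChartedSpace (EuclideanSpace ℝ (Fin m)) M]
  [IsManifold (𝓡 m) ∞ M] [T2Space M]
  {V : Type*} [NormedAddCommGroup V] [NormedSpace ℝ V] [NormedSpace 𝕜 V] [IsScalarTower ℝ 𝕜 V]
  [FiniteDimensional 𝕜 V]
  {E : M → Type*} [TopologicalSpace (TotalSpace V E)] [∀ x, TopologicalSpace (E x)]
  [∀ x, AddCommGroup (E x)] [∀ x, Module ℝ (E x)] [∀ x, Module 𝕜 (E x)]
  [∀ x, IsScalarTower ℝ 𝕜 (E x)]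
  [FiberBundle V E] [VectorBundle ℝ V E] [VectorBundle 𝕜 V E] [ContMDiffVectorBundle ∞ V E (𝓡 m)]
  [MulAction G M] [ContMDiffSMul (𝓡 q) (𝓡 m) ∞ G M]
  [MulAction G (TotalSpace V E)] [ContMDiffSMul (𝓡 q) ((𝓡 m).prod 𝓘(ℝ, V)) ∞ G (TotalSpace V E)]
  {F : Type*} [NormedAddCommGroup F] [NormedSpace ℝ F]

/-- The restriction of a trivialization of `E` to a transversal is a frame. -/
theorem isFrame_trivialization {U : Set F} {σ : F → M} (hU : IsOpen U)
    (hσ : ContMDiffOn 𝓘(ℝ, F) (𝓡 m) ∞ σ U)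
    (t : Trivialization V (TotalSpace.proj : TotalSpace V E → M)) [MemTrivializationAtlas t]
    (ht : MapsTo σ U t.baseSet) :
    IsFrame 𝕜 m U σ (fun y : F × V => t.toOpenPartialHomeomorph.symm (σ y.1, y.2)) where
  isOpen := hU
  smooth := hσ
  smooth_total := by
    have h1 : ContMDiffOn 𝓘(ℝ, F × V) ((𝓡 m).prod 𝓘(ℝ, V)) ∞
        (fun y : F × V => (σ y.1, y.2)) (U ×ˢ univ) :=
      (hσ.comp (contDiff_fst.contMDiff.contMDiffOn) fun y hy => hy.1).prodMk
        contDiff_snd.contMDiff.contMDiffOn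
    refine t.contMDiffOn_symm.comp h1 fun y hy => ?_
    rw [mem_preimage, t.mem_target]
    exact ht hy.1
  linear z hz := ⟨(t.linearEquivAt 𝕜 (σ z) (ht hz)).symm, fun v =>
    ((t.mk_symm (ht hz) v).symm.trans (by rfl))⟩

variable (𝕜 G V E) in
/-- The points whose isotropy group acts trivially on the fibre. -/
def trivialIsotropy : Set M :=
  {y : M | ∀ g ∈ MulAction.stabilizer G y, ∀ v : E y, g • (⟨y, v⟩ : TotalSpace V E) = ⟨y, v⟩}

theorem smul_mem_trivialIsotropy (hlin : ActsLinearly 𝕜 G V E) {g : G} {y : M}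
    (hy : g • y ∈ trivialIsotropy G V E) : y ∈ trivialIsotropy G V E := by
  intro k hk v
  have hk' : g * k * g⁻¹ ∈ MulAction.stabilizer G (g • y) := by
    rw [MulAction.mem_stabilizer_iff, mul_smul, mul_smul, inv_smul_smul,
      MulAction.mem_stabilizer_iff.1 hk]
  obtain ⟨L, hL⟩ := hlin g y
  have h := hy _ hk' (L v)
  rw [← hL, mul_smul, mul_smul, inv_smul_smul] at h
  exact MulAction.injective g h

/-- An element of `G` that fixes the points of a transversal fixes the fibres over them: it does so
over a dense set of points. -/
theorem smul_eq_of_fixes_transversal (hlin : ActsLinearly 𝕜 G V E)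
    (hgen : Dense (trivialIsotropy G V E)) {U : Set F} {σ : F → M} {S : F × V → TotalSpace V E}
    (h : IsFrame 𝕜 m U σ S)
    (hd : IsLocalDiffeomorphOn ((𝓡 q).prod 𝓘(ℝ, F)) (𝓡 m) ∞
      (fun y : G × F => y.1 • σ y.2) (univ ×ˢ U)) {k : G} (hk : ∀ z ∈ U, k • σ z = σ z)
    {z : F} (hz : z ∈ U) (v : V) : k • S (z, v) = S (z, v) := by
  have : T2Space (TotalSpace V E) := t2Space_totalSpace E
  have hcS : ContinuousOn (fun z => S (z, v)) U :=
    h.smooth_total.continuousOn.comp (by fun_prop) fun z hz => ⟨hz, mem_univ v⟩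
  have hck : Continuous fun e : TotalSpace V E => k • e :=
    (ContMDiffSMul.contMDiff_const_smul (I := 𝓡 q) (I' := (𝓡 m).prod 𝓘(ℝ, V)) (n := ∞) k).continuous
  -- the set of points with trivial isotropy is invariant, and `(g, z) ↦ g • σ z` is open
  have hsub : U ⊆ closure (U ∩ σ ⁻¹' trivialIsotropy G V E) := by
    intro z hz
    rw [mem_closure_iff_nhds]
    intro T hT
    have hTU : (univ : Set G) ×ˢ (T ∩ U) ∈ 𝓝 ((1 : G), z) :=
      prod_mem_nhds Filter.univ_mem (Filter.inter_mem hT (h.isOpen.mem_nhds hz))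
    obtain ⟨y, hy, ⟨⟨g, w⟩, hw, rfl⟩⟩ := hgen.inter_nhds_nonempty
      (isLocalDiffeomorphAt_image_mem_nhds (hd ⟨(1, z), mem_univ _, hz⟩) hTU)
    exact ⟨w, hw.2.1, hw.2.2, smul_mem_trivialIsotropy hlin hy⟩
  refine EqOn.of_subset_closure (s := U ∩ σ ⁻¹' trivialIsotropy G V E) (fun w hw => ?_)
    (hck.comp_continuousOn hcS) hcS inter_subset_left hsub hz
  obtain ⟨L, hL⟩ := h.linear w hw.1
  change k • S (w, v) = S (w, v)
  rw [hL]
  exact hw.2 k (hk w hw.1) _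

/-- `σ` is a slice at `x`, on which the stabilizer of `x` acts through the representation `ρ`. -/
structure IsLinearSlice (m q : ℕ)
    {G : Type u} [Group G] [TopologicalSpace G] [ChartedSpace (EuclideanSpace ℝ (Fin q)) G]
    {M : Type*} [TopologicalSpace M] [ChartedSpace (EuclideanSpace ℝ (Fin m)) M] [MulAction G M]
    {F : Type*} [NormedAddCommGroup F] [NormedSpace ℝ F] (x : M)
    (ρ : MulAction.stabilizer G x →* (F →L[ℝ] F)) (σ : F → M) (U : Set F) : Prop where
  isOpen : IsOpen U
  zero_mem : 0 ∈ U
  mapsTo : ∀ k, MapsTo (ρ k) U U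
  center : σ 0 = x
  smooth : ContMDiffOn 𝓘(ℝ, F) (𝓡 m) ∞ σ U
  equivariant : ∀ z ∈ U, ∀ k : MulAction.stabilizer G x, σ (ρ k z) = (k : G) • σ z
  localDiffeo : IsLocalDiffeomorphOn ((𝓡 q).prod 𝓘(ℝ, F)) (𝓡 m) ∞
    (fun y : G × F => y.1 • σ y.2) (univ ×ˢ U)
  slice : ∀ z ∈ U, ∀ w ∈ U, ∀ g : G, g • σ z = σ w →
    ∃ hg : g ∈ MulAction.stabilizer G x, ρ ⟨g, hg⟩ z = w

/-- The chart data given by a linear slice `σ` on `U` and a frame `S` over it. The group is the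
quotient of the stabilizer by the kernel of the slice representation. It acts on `U × V` through
arbitrary representatives; the choice is irrelevant when the kernel acts trivially on `E` over the
slice. -/
noncomputable def sliceChart {x : M} (ρ : MulAction.stabilizer G x →* (F →L[ℝ] F)) (σ : F → M)
    (U : Set F) (S : F × V → TotalSpace V E) :
    BundleChartData.{u} F V (MulAction.orbitRel.Quotient G M)
      (MulAction.orbitRel.Quotient G (TotalSpace V E)) where
  source := U
  Γ := MulAction.stabilizer G x ⧸ ρ.ker
  act γ := effectiveRep ρ γ
  target := (fun z => Quotient.mk _ (σ z)) '' U
  proj z := Quotient.mk _ (σ z)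
  actTotal γ y := (effectiveRep ρ γ y.1,
    fiberCoord S (effectiveRep ρ γ y.1) (((γ.out : MulAction.stabilizer G x) : G) • S y))
  projTotal y := Quotient.mk _ (S y)

theorem mk_eq_mk_iff {X : Type*} [MulAction G X] {a b : X} :
    (Quotient.mk _ a : MulAction.orbitRel.Quotient G X) = Quotient.mk _ b ↔ ∃ g : G, g • a = b := by
  rw [eq_comm, Quotient.eq, MulAction.orbitRel_apply, MulAction.mem_orbit_iff]

namespace IsLinearSlice

variable {x : M} {ρ : MulAction.stabilizer G x →* (F →L[ℝ] F)} {σ : F → M} {U : Set F}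
  {S : F × V → TotalSpace V E}

theorem effectiveRep_mapsTo (h : IsLinearSlice m q x ρ σ U) (γ : MulAction.stabilizer G x ⧸ ρ.ker) :
    MapsTo (effectiveRep ρ γ) U U := by
  induction γ using QuotientGroup.induction_on with
  | H k => exact h.mapsTo k

theorem isOpen_image (h : IsLinearSlice m q x ρ σ U) {W : Set F} (hW : IsOpen W) (hWU : W ⊆ U) :
    IsOpen ((fun z => (Quotient.mk _ (σ z) : MulAction.orbitRel.Quotient G M)) '' W) := by
  have : ContinuousSMul G M := ContMDiffSMul.continuousSMul (I := 𝓡 q) (I' := 𝓡 m) ∞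
  have h1 : IsOpen ((fun y : G × F => y.1 • σ y.2) '' (univ ×ˢ W)) := by
    rw [isOpen_iff_mem_nhds]
    rintro _ ⟨⟨g, z⟩, ⟨-, hz⟩, rfl⟩
    exact isLocalDiffeomorphAt_image_mem_nhds (h.localDiffeo ⟨(g, z), mem_univ _, hWU hz⟩)
      ((isOpen_univ.prod hW).mem_nhds ⟨mem_univ _, hz⟩)
  have h2 := (MulAction.isOpenQuotientMap_quotientMk (Γ := G) (T := M)).isOpenMap _ h1
  convert h2 using 1
  ext y
  constructor
  · rintro ⟨z, hz, rfl⟩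
    exact ⟨σ z, ⟨(1, z), ⟨mem_univ _, hz⟩, one_smul G _⟩, rfl⟩
  · rintro ⟨_, ⟨⟨g, z⟩, ⟨-, hz⟩, rfl⟩, rfl⟩
    exact ⟨z, hz, mk_eq_mk_iff.2 ⟨g, rfl⟩⟩

/-- The images in `E / G` of the open subsets of `U × V` are open. -/
theorem isOpen_image_total (h : IsLinearSlice m q x ρ σ U) (hlin : ActsLinearly 𝕜 G V E)
    (t : Trivialization V (TotalSpace.proj : TotalSpace V E → M)) (ht : MapsTo σ U t.baseSet)
    {W : Set (F × V)} (hW : IsOpen W) (hWU : W ⊆ U ×ˢ univ) :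
    IsOpen ((fun y => (Quotient.mk _ (t.toOpenPartialHomeomorph.symm (σ y.1, y.2)) :
      MulAction.orbitRel.Quotient G (TotalSpace V E))) '' W) := by
  have : IsTopologicalGroup G := topologicalGroup_of_lieGroup (𝓡 q) ∞
  have : ContinuousSMul G (TotalSpace V E) :=
    ContMDiffSMul.continuousSMul (I := 𝓡 q) (I' := (𝓡 m).prod 𝓘(ℝ, V)) ∞
  set S : F × V → TotalSpace V E := fun y => t.toOpenPartialHomeomorph.symm (σ y.1, y.2) with hS
  have hproj : ∀ z ∈ U, ∀ v, (S (z, v)).proj = σ z := fun z hz v => t.proj_symm_apply' (ht hz)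
  have h1 : IsOpen {e : TotalSpace V E | ∃ (g : G), ∃ y ∈ W, g • S y = e} := by
    rw [isOpen_iff_mem_nhds]
    rintro _ ⟨g₀, ⟨z₀, v₀⟩, hy₀, rfl⟩
    have hz₀ : z₀ ∈ U := (hWU hy₀).1
    obtain ⟨p, hp₀, hp⟩ := exists_smooth_coordinates (h.localDiffeo ⟨(g₀, z₀), mem_univ _, hz₀⟩)
    have hpr : (g₀ • S (z₀, v₀)).proj = g₀ • σ z₀ := by rw [hlin.proj_smul, hproj z₀ hz₀]
    have hcπ : ContinuousAt (fun e : TotalSpace V E => e.proj) (g₀ • S (z₀, v₀)) :=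
      (FiberBundle.continuous_proj V E).continuousAt
    have hcp : ContinuousAt (fun e : TotalSpace V E => p e.proj) (g₀ • S (z₀, v₀)) :=
      ContinuousAt.comp_of_eq hp.self_of_nhds.1.continuousAt hcπ hpr
    have hcf : ContinuousAt (fun e : TotalSpace V E => (p e.proj).1⁻¹ • e) (g₀ • S (z₀, v₀)) :=
      hcp.fst.inv.smul continuousAt_id
    have hval : (p (g₀ • S (z₀, v₀)).proj) = (g₀, z₀) := by rw [hpr, hp₀]
    have hf₀ : (p (g₀ • S (z₀, v₀)).proj).1⁻¹ • (g₀ • S (z₀, v₀)) = S (z₀, v₀) := by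
      rw [hval, inv_smul_smul]
    have hmem : S (z₀, v₀) ∈ t.source := by
      rw [t.mem_source, hproj z₀ hz₀]
      exact ht hz₀
    have hct : ContinuousAt (fun e : TotalSpace V E => (t ((p e.proj).1⁻¹ • e)).2)
        (g₀ • S (z₀, v₀)) := by
      have h2 : ContinuousAt t (S (z₀, v₀)) :=
        t.continuousOn.continuousAt (t.open_source.mem_nhds hmem)
      exact (ContinuousAt.comp_of_eq h2 hcf hf₀).snd
    have hcy : ContinuousAt (fun e : TotalSpace V E =>
        ((p e.proj).2, (t ((p e.proj).1⁻¹ • e)).2)) (g₀ • S (z₀, v₀)) := hcp.snd.prodMk hct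
    have hval2 : (t (S (z₀, v₀))).2 = v₀ := by
      simp only [hS]
      rw [t.apply_symm_apply' (ht hz₀)]
    filter_upwards [hcy.eventually_mem (hW.mem_nhds (by rw [hf₀, hval, hval2]; exact hy₀)),
      hcπ.eventually (hpr.symm ▸ hp)] with e he hpe
    refine ⟨(p e.proj).1, _, he, ?_⟩
    have hU : (p e.proj).2 ∈ U := (hWU he).1
    have h3 : ((p e.proj).1⁻¹ • e).proj = σ (p e.proj).2 := by
      rw [hlin.proj_smul, inv_smul_eq_iff]
      exact hpe.2.symm
    have h4 : S ((p e.proj).2, (t ((p e.proj).1⁻¹ • e)).2) = (p e.proj).1⁻¹ • e := by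
      simp only [hS]
      rw [← h3]
      exact t.symm_apply_mk_proj (by rw [t.mem_source, h3]; exact ht hU)
    rw [h4, smul_inv_smul]
  have h2 := (MulAction.isOpenQuotientMap_quotientMk (Γ := G) (T := TotalSpace V E)).isOpenMap _ h1
  convert h2 using 1
  ext y
  constructor
  · rintro ⟨z, hz, rfl⟩
    exact ⟨S z, ⟨1, z, hz, one_smul G _⟩, rfl⟩
  · rintro ⟨_, ⟨g, z, hz, rfl⟩, rfl⟩
    exact ⟨z, hz, mk_eq_mk_iff.2 ⟨g, rfl⟩⟩

end IsLinearSlice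

end Charts

section Charts

set_option linter.unusedSectionVars false

variable {𝕜 : Type*} [RCLike 𝕜] {m q : ℕ}
  {G : Type u} [Group G] [TopologicalSpace G] [ChartedSpace (EuclideanSpace ℝ (Fin q)) G]
  [LieGroup (𝓡 q) ∞ G]
  {M : Type*} [TopologicalSpace M] [ChartedSpace (EuclideanSpace ℝ (Fin m)) M]
  [IsManifold (𝓡 m) ∞ M] [T2Space M]
  {V : Type*} [NormedAddCommGroup V] [NormedSpace ℝ V] [NormedSpace 𝕜 V] [IsScalarTower ℝ 𝕜 V]
  [FiniteDimensional 𝕜 V]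
  {E : M → Type*} [TopologicalSpace (TotalSpace V E)] [∀ x, TopologicalSpace (E x)]
  [∀ x, AddCommGroup (E x)] [∀ x, Module ℝ (E x)] [∀ x, Module 𝕜 (E x)]
  [∀ x, IsScalarTower ℝ 𝕜 (E x)]
  [FiberBundle V E] [VectorBundle ℝ V E] [VectorBundle 𝕜 V E] [ContMDiffVectorBundle ∞ V E (𝓡 m)]
  [MulAction G M] [ContMDiffSMul (𝓡 q) (𝓡 m) ∞ G M]
  [MulAction G (TotalSpace V E)] [ContMDiffSMul (𝓡 q) ((𝓡 m).prod 𝓘(ℝ, V)) ∞ G (TotalSpace V E)]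
  {F : Type*} [NormedAddCommGroup F] [NormedSpace ℝ F]

namespace IsLinearSlice

variable {x : M} {ρ : MulAction.stabilizer G x →* (F →L[ℝ] F)} {σ : F → M} {U : Set F}
  {S : F × V → TotalSpace V E}

theorem injOn (h : IsLinearSlice m q x ρ σ U) {z w : F} (hz : z ∈ U) (hw : w ∈ U)
    (hzw : σ z = σ w) : z = w := by
  obtain ⟨hg, hgz⟩ := h.slice z hz w hw 1 (by rw [one_smul, hzw])
  rw [← hgz, show (⟨1, hg⟩ : MulAction.stabilizer G x) = 1 from rfl, map_one]
  rfl

theorem injOn_total (h : IsLinearSlice m q x ρ σ U) (hS : IsFrame 𝕜 m U σ S) {y y' : F × V}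
    (hy : y.1 ∈ U) (hy' : y'.1 ∈ U) (he : S y = S y') : y = y' := by
  obtain ⟨z, v⟩ := y
  obtain ⟨z', v'⟩ := y'
  obtain rfl : z = z' := h.injOn hy hy' (by rw [← hS.proj hy v, ← hS.proj hy' v', he])
  rw [hS.injective hy he]

theorem faithful (h : IsLinearSlice m q x ρ σ U) {γ : MulAction.stabilizer G x ⧸ ρ.ker}
    (hγ : ∀ z ∈ U, effectiveRep ρ γ z = z) : γ = 1 := by
  refine effectiveRep_injective ρ ?_
  -- a linear map is its own derivative at `0`
  have h1 : HasFDerivAt (id : F → F) (effectiveRep ρ γ) 0 := by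
    refine (effectiveRep ρ γ).hasFDerivAt.congr_of_eventuallyEq ?_
    filter_upwards [h.isOpen.mem_nhds h.zero_mem] with z hz
    exact (hγ z hz).symm
  exact h1.unique (hasFDerivAt_id 0)

/-- The representative of a class that is used by `sliceChart` acts as any other does. -/
theorem out_smul (hlin : ActsLinearly 𝕜 G V E)
    (hgen : Dense (trivialIsotropy G V E)) (h : IsLinearSlice m q x ρ σ U)
    (hS : IsFrame 𝕜 m U σ S) (k : MulAction.stabilizer G x) {z : F} (hz : z ∈ U) (v : V) :
    ((Quotient.out (k : MulAction.stabilizer G x ⧸ ρ.ker) : MulAction.stabilizer G x) : G) •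
      S (z, v) = (k : G) • S (z, v) := by
  obtain ⟨l, hl⟩ := QuotientGroup.mk_out_eq_mul ρ.ker k
  have hfix : ∀ w ∈ U, ((l : MulAction.stabilizer G x) : G) • σ w = σ w := fun w hw => by
    rw [← h.equivariant w hw, show ρ l = 1 from l.2]
    rfl
  rw [hl, Subgroup.coe_mul, mul_smul,
    smul_eq_of_fixes_transversal hlin hgen hS h.localDiffeo hfix hz v]

theorem apply_actTotal (hlin : ActsLinearly 𝕜 G V E)
    (hgen : Dense (trivialIsotropy G V E)) (h : IsLinearSlice m q x ρ σ U)
    (hS : IsFrame 𝕜 m U σ S) (k : MulAction.stabilizer G x) {y : F × V} (hy : y.1 ∈ U) :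
    S ((sliceChart ρ σ U S).actTotal (k : MulAction.stabilizer G x ⧸ ρ.ker) y) = (k : G) • S y := by
  have h1 := h.out_smul hlin hgen hS k hy y.2
  refine (hS.apply_fiberCoord (h.mapsTo k hy) ?_).trans h1
  refine (congrArg TotalSpace.proj h1).trans ?_
  rw [hlin.proj_smul, hS.proj hy, ← h.equivariant _ hy]

theorem contDiffOn_actTotal (hlin : ActsLinearly 𝕜 G V E)
    (hgen : Dense (trivialIsotropy G V E)) (h : IsLinearSlice m q x ρ σ U)
    (hS : IsFrame 𝕜 m U σ S) (γ : MulAction.stabilizer G x ⧸ ρ.ker) :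
    ContDiffOn ℝ ∞ ((sliceChart ρ σ U S).actTotal γ) (U ×ˢ univ) := by
  rintro ⟨z, v⟩ ⟨hz, -⟩
  have hfst : ContDiffAt ℝ ∞ (fun y : F × V => effectiveRep ρ γ y.1) (z, v) :=
    (effectiveRep ρ γ).contDiff.contDiffAt.comp (z, v) contDiffAt_fst
  refine (hfst.prodMk (hS.contDiffAt_fiberCoord hfst ?_ (h.effectiveRep_mapsTo γ hz)
    ?_)).contDiffWithinAt
  · exact (ContMDiffSMul.contMDiff_const_smul (I := 𝓡 q) (I' := (𝓡 m).prod 𝓘(ℝ, V)) (n := ∞)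
      (M := TotalSpace V E) _).contMDiffAt.comp (z, v)
      (hS.smooth_total.contMDiffAt ((h.isOpen.prod isOpen_univ).mem_nhds ⟨hz, mem_univ v⟩))
  · filter_upwards [(h.isOpen.prod isOpen_univ).mem_nhds
      (show (z, v) ∈ U ×ˢ univ from ⟨hz, mem_univ v⟩)]
      with y hy
    induction γ using QuotientGroup.induction_on with
    | H k =>
      refine (congrArg TotalSpace.proj (h.out_smul hlin hgen hS k hy.1 y.2)).trans ?_
      rw [hlin.proj_smul, hS.proj hy.1, ← h.equivariant _ hy.1]
      rfl

variable [∀ x : M, Finite (MulAction.stabilizer G x)]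

theorem isOrbifoldChart (h : IsLinearSlice m q x ρ σ U) :
    IsOrbifoldChart (sliceChart ρ σ U S).toChartData where
  finite := inferInstanceAs (Finite (MulAction.stabilizer G x ⧸ ρ.ker))
  isOpen_source := h.isOpen
  isOpen_target := h.isOpen_image h.isOpen subset_rfl
  mapsTo γ := h.effectiveRep_mapsTo γ
  one_act z _ := congrArg (fun L : F →L[ℝ] F => L z) (map_one (effectiveRep ρ))
  mul_act γ γ' z _ := congrArg (fun L : F →L[ℝ] F => L z) (map_mul (effectiveRep ρ) γ γ')
  smooth γ := (effectiveRep ρ γ).contDiff.contDiffOn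
  faithful γ hγ := h.faithful hγ
  continuousOn := continuous_quot_mk.comp_continuousOn h.smooth.continuousOn
  image := rfl
  fiber z hz w hw := by
    refine mk_eq_mk_iff.trans ⟨?_, ?_⟩
    · rintro ⟨g, hg⟩
      obtain ⟨hgx, hgz⟩ := h.slice z hz w hw g hg
      exact ⟨((⟨g, hgx⟩ : MulAction.stabilizer G x) : MulAction.stabilizer G x ⧸ ρ.ker), hgz⟩
    · rintro ⟨γ, hγ⟩
      obtain ⟨k, rfl⟩ := QuotientGroup.mk_surjective γ
      refine ⟨k, ?_⟩
      rw [← h.equivariant z hz]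
      exact congrArg σ hγ
  isOpen_image W hW hWo := h.isOpen_image hWo hW

theorem isOrbifoldChart_total (hlin : ActsLinearly 𝕜 G V E)
    (hgen : Dense (trivialIsotropy G V E)) (h : IsLinearSlice m q x ρ σ U)
    (hS : IsFrame 𝕜 m U σ S)
    (hopen : ∀ W ⊆ U ×ˢ univ, IsOpen W → IsOpen ((fun y => (Quotient.mk _ (S y) :
      MulAction.orbitRel.Quotient G (TotalSpace V E))) '' W)) :
    IsOrbifoldChart ((sliceChart ρ σ U S).total (orbitProj hlin)) := by
  have hact : ∀ (k : MulAction.stabilizer G x) (y : F × V), y.1 ∈ U →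
      S ((sliceChart ρ σ U S).actTotal (k : MulAction.stabilizer G x ⧸ ρ.ker) y) = (k : G) • S y :=
    fun k y hy => h.apply_actTotal hlin hgen hS k hy
  have hmap : ∀ (γ : MulAction.stabilizer G x ⧸ ρ.ker) (y : F × V), y.1 ∈ U →
      ((sliceChart ρ σ U S).actTotal γ y).1 ∈ U := fun γ y hy => h.effectiveRep_mapsTo γ hy
  have himage : (fun y => (Quotient.mk _ (S y) : MulAction.orbitRel.Quotient G (TotalSpace V E))) ''
      (U ×ˢ univ) = orbitProj hlin ⁻¹' (sliceChart ρ σ U S).target := by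
    ext e
    constructor
    · rintro ⟨y, hy, rfl⟩
      exact ⟨y.1, hy.1, congrArg (Quotient.mk _) (hS.proj hy.1 y.2).symm⟩
    · induction e using Quotient.inductionOn with
      | h e =>
        rintro ⟨z, hz, hze⟩
        obtain ⟨g, hg⟩ := mk_eq_mk_iff.1 hze
        have hpr : (g⁻¹ • e).proj = σ z := by
          rw [hlin.proj_smul, inv_smul_eq_iff, hg]
        refine ⟨(z, fiberCoord S z (g⁻¹ • e)), ⟨hz, mem_univ _⟩, mk_eq_mk_iff.2 ⟨g, ?_⟩⟩
        rw [hS.apply_fiberCoord hz hpr, smul_inv_smul]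
  exact
  { finite := inferInstanceAs (Finite (MulAction.stabilizer G x ⧸ ρ.ker))
    isOpen_source := h.isOpen.prod isOpen_univ
    isOpen_target := by
      refine (himage ▸ hopen _ subset_rfl (h.isOpen.prod isOpen_univ) :)
    mapsTo := fun γ y hy => ⟨hmap γ y hy.1, mem_univ _⟩
    one_act := fun y hy => by
      refine h.injOn_total hS (hmap 1 y hy.1) hy.1 ((hact 1 y hy.1).trans ?_)
      rw [OneMemClass.coe_one, one_smul]
    mul_act := fun γ γ' y hy => by
      obtain ⟨k, rfl⟩ := QuotientGroup.mk_surjective γ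
      obtain ⟨k', rfl⟩ := QuotientGroup.mk_surjective γ'
      refine h.injOn_total hS (hmap _ y hy.1) (hmap _ _ (hmap _ _ hy.1)) ?_
      refine (hact (k * k') y hy.1).trans ?_
      refine Eq.trans ?_ (hact k _ (hmap _ _ hy.1)).symm
      refine Eq.trans ?_ (congrArg (fun e => (k : G) • e) (hact k' y hy.1)).symm
      rw [Subgroup.coe_mul, mul_smul]
    smooth := fun γ => h.contDiffOn_actTotal hlin hgen hS γ
    faithful := fun γ hγ => h.faithful fun z hz =>
      congrArg Prod.fst (hγ (z, 0) ⟨hz, mem_univ _⟩)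
    continuousOn := continuous_quot_mk.comp_continuousOn hS.smooth_total.continuousOn
    image := himage
    fiber := fun y hy y' hy' => by
      refine mk_eq_mk_iff.trans ⟨?_, ?_⟩
      · rintro ⟨g, hg⟩
        have hσ : g • σ y.1 = σ y'.1 := by
          rw [← hS.proj hy.1 y.2, ← hS.proj hy'.1 y'.2, ← hlin.proj_smul]
          exact congrArg TotalSpace.proj hg
        obtain ⟨hgx, hgz⟩ := h.slice y.1 hy.1 y'.1 hy'.1 g hσ
        refine ⟨((⟨g, hgx⟩ : MulAction.stabilizer G x) : MulAction.stabilizer G x ⧸ ρ.ker), ?_⟩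
        exact h.injOn_total hS (hmap _ y hy.1) hy'.1 ((hact _ y hy.1).trans hg)
      · rintro ⟨γ, hγ⟩
        obtain ⟨k, rfl⟩ := QuotientGroup.mk_surjective γ
        exact ⟨k, (hact k y hy.1).symm.trans (congrArg S hγ)⟩
    isOpen_image := hopen }

theorem isBundleChart (hlin : ActsLinearly 𝕜 G V E)
    (hgen : Dense (trivialIsotropy G V E)) (h : IsLinearSlice m q x ρ σ U)
    (hS : IsFrame 𝕜 m U σ S)
    (hopen : ∀ W ⊆ U ×ˢ univ, IsOpen W → IsOpen ((fun y => (Quotient.mk _ (S y) :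
      MulAction.orbitRel.Quotient G (TotalSpace V E))) '' W)) :
    IsBundleChart 𝕜 (orbitProj hlin) (sliceChart ρ σ U S) where
  base := h.isOrbifoldChart
  total := h.isOrbifoldChart_total hlin hgen hS hopen
  act_fst γ z hz v := rfl
  act_linear γ z hz := by
    obtain ⟨k, rfl⟩ := QuotientGroup.mk_surjective γ
    refine hS.isLinearMap_transition hlin hS hz (h.mapsTo k hz) (g := (k : G)⁻¹) fun v => ?_
    rw [inv_smul_eq_iff]
    exact h.apply_actTotal hlin hgen hS k (y := (z, v)) hz
  comm z hz v := congrArg (Quotient.mk _) (hS.proj hz v)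

end IsLinearSlice

/-- Every point lies in the target of a chart of the canonical atlas whose group acts linearly on a
neighbourhood of `0`. -/
theorem exists_linear_chart [CompactSpace G] [∀ x : M, Finite (MulAction.stabilizer G x)]
    (hlin : ActsLinearly 𝕜 G V E) (hgen : Dense (trivialIsotropy G V E)) (x : M) :
    ∃ (R : BundleChartData.{u} (EuclideanSpace ℝ (Fin (m - q))) V
        (MulAction.orbitRel.Quotient G M) (MulAction.orbitRel.Quotient G (TotalSpace V E)))
      (σ : EuclideanSpace ℝ (Fin (m - q)) → M)
      (S : EuclideanSpace ℝ (Fin (m - q)) × V → TotalSpace V E)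
      (θ : MulAction.stabilizer G x →* R.Γ)
      (A : R.Γ → EuclideanSpace ℝ (Fin (m - q)) →L[ℝ] EuclideanSpace ℝ (Fin (m - q))),
      IsBundleChart 𝕜 (orbitProj hlin) R ∧ IsSlice (q := q) 𝕜 G V E R x σ S θ ∧
      ∀ γ, R.act γ = A γ := by
  have : T1Space G := ChartedSpace.t1Space (EuclideanSpace ℝ (Fin q)) G
  set t := trivializationAt V E x
  obtain ⟨ρ, σ, U, h1, h2, h3, h4, h5, h6, h7, h8, h9⟩ := exists_slice (𝓡 q) (𝓡 m) (G := G) x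
    (q := q) (m := m) (by simp) (by simp)
    (t.open_baseSet.mem_nhds (FiberBundle.mem_baseSet_trivializationAt' x))
  have h : IsLinearSlice m q x ρ σ U := ⟨h1, h2, h3, h4, h6, h7, h8, h9⟩
  set S : EuclideanSpace ℝ (Fin (m - q)) × V → TotalSpace V E :=
    fun y => t.toOpenPartialHomeomorph.symm (σ y.1, y.2) 
  have hS : IsFrame 𝕜 m U σ S := isFrame_trivialization h1 h6 t h5
  refine ⟨sliceChart ρ σ U S, σ, S, QuotientGroup.mk' ρ.ker, effectiveRep ρ,
    h.isBundleChart hlin hgen hS fun W hW hWo => h.isOpen_image_total hlin t h5 hWo hW, ?_,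
    fun γ => rfl⟩
  exact
  { zero_mem := h2
    center := h4
    smooth := h6
    smooth_total := hS.smooth_total
    linear := hS.linear
    surjective := QuotientGroup.mk'_surjective _
    equivariant := fun g z hz => h7 z hz g
    equivariant_total := fun g z hz v => h.apply_actTotal hlin hgen hS g hz
    localDiffeo := h8
    slice := h9
    proj_eq := fun z hz => rfl
    projTotal_eq := fun z hz v => rfl }

end Charts

/-! ### The canonical atlas -/

section Atlas

set_option linter.unusedSectionVars false

variable {𝕜 : Type*} [RCLike 𝕜] {m q : ℕ}
  {G : Type u} [Group G] [TopologicalSpace G] [ChartedSpace (EuclideanSpace ℝ (Fin q)) G]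
  [LieGroup (𝓡 q) ∞ G]
  {M : Type*} [TopologicalSpace M] [ChartedSpace (EuclideanSpace ℝ (Fin m)) M]
  [IsManifold (𝓡 m) ∞ M] [T2Space M]
  {V : Type*} [NormedAddCommGroup V] [NormedSpace ℝ V] [NormedSpace 𝕜 V] [IsScalarTower ℝ 𝕜 V]
  [FiniteDimensional 𝕜 V]
  {E : M → Type*} [TopologicalSpace (TotalSpace V E)] [∀ x, TopologicalSpace (E x)]
  [∀ x, AddCommGroup (E x)] [∀ x, Module ℝ (E x)] [∀ x, Module 𝕜 (E x)]
  [∀ x, IsScalarTower ℝ 𝕜 (E x)]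
  [FiberBundle V E] [VectorBundle ℝ V E] [VectorBundle 𝕜 V E] [ContMDiffVectorBundle ∞ V E (𝓡 m)]
  [MulAction G M] [ContMDiffSMul (𝓡 q) (𝓡 m) ∞ G M]
  [MulAction G (TotalSpace V E)] [ContMDiffSMul (𝓡 q) ((𝓡 m).prod 𝓘(ℝ, V)) ∞ G (TotalSpace V E)]

theorem IsSlice.isFrame {p : MulAction.orbitRel.Quotient G (TotalSpace V E) →
      MulAction.orbitRel.Quotient G M}
    {R : BundleChartData.{u} (EuclideanSpace ℝ (Fin (m - q))) V
      (MulAction.orbitRel.Quotient G M) (MulAction.orbitRel.Quotient G (TotalSpace V E))}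
    {x : M} {σ : EuclideanSpace ℝ (Fin (m - q)) → M}
    {S : EuclideanSpace ℝ (Fin (m - q)) × V → TotalSpace V E}
    {θ : MulAction.stabilizer G x →* R.Γ} (hR : IsBundleChart 𝕜 p R)
    (h : IsSlice (q := q) 𝕜 G V E R x σ S θ) : IsFrame 𝕜 m R.source σ S :=
  ⟨hR.base.isOpen_source, h.smooth, h.smooth_total, h.linear⟩

variable {hlin : ActsLinearly 𝕜 G V E}
  {R₁ R₂ : BundleChartData.{u} (EuclideanSpace ℝ (Fin (m - q))) V
    (MulAction.orbitRel.Quotient G M) (MulAction.orbitRel.Quotient G (TotalSpace V E))}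

theorem bundleCompatible_of_mem_canonicalAtlas (h₁ : R₁ ∈ canonicalAtlas (m := m) (q := q) hlin)
    (h₂ : R₂ ∈ canonicalAtlas (m := m) (q := q) hlin) : BundleCompatible 𝕜 R₁ R₂ := by
  obtain ⟨hR₁, x₁, σ₁, S₁, θ₁, s₁⟩ := h₁
  obtain ⟨hR₂, x₂, σ₂, S₂, θ₂, s₂⟩ := h₂
  intro z₁ hz₁ z₂ hz₂ hz
  rw [s₁.proj_eq z₁ hz₁, s₂.proj_eq z₂ hz₂, eq_comm] at hz
  obtain ⟨g₀, hg₀⟩ := mk_eq_mk_iff.1 hz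
  obtain ⟨h, H, hd, hD, h1, h2, h3, h4, h5, h6, h7, h8, h9, -⟩ := exists_transition hlin
    (s₁.isFrame hR₁) (s₂.isFrame hR₂) s₁.localDiffeo s₂.localDiffeo hz₁ hz₂ hg₀
  refine ⟨h, H, hd, hD, h1, h2, h3, h4, h5, h6, h7, h8, fun z hz => ?_, fun z hz v => ?_⟩
  · obtain ⟨g, hg, -⟩ := h9 z hz
    rw [s₁.proj_eq z (h3 hz), s₂.proj_eq _ (h4 (h.map_source hz))]
    exact mk_eq_mk_iff.2 ⟨g, hg⟩
  · obtain ⟨g, -, hg⟩ := h9 z hz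
    have h10 : (H (z, v)).1 ∈ R₂.source := by
      rw [h7 z hz]
      exact h4 (h.map_source hz)
    rw [s₁.projTotal_eq z (h3 hz), ← Prod.mk.eta (p := H (z, v)), s₂.projTotal_eq _ h10]
    exact mk_eq_mk_iff.2 ⟨g, hg v⟩

theorem BundleCompatible.compatible (h : BundleCompatible 𝕜 R₁ R₂) :
    Compatible R₁.toChartData R₂.toChartData := fun z₁ hz₁ z₂ hz₂ hz => by
  obtain ⟨h, H, hd, hD, h1, h2, h3, h4, h5, h6, h7, h8, h9, -⟩ := h z₁ hz₁ z₂ hz₂ hz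
  exact ⟨h, hd, h1, h2, h3, h4, h9⟩

/-- Compatibility of the charts on the total space is not a formal consequence of the compatibility
as orbibundle charts: the transition map has to take a given vector to a given vector in the same
orbit, hence it is constructed from an element of `G` that relates these vectors. -/
theorem compatible_total_of_mem_canonicalAtlas (h₁ : R₁ ∈ canonicalAtlas (m := m) (q := q) hlin)
    (h₂ : R₂ ∈ canonicalAtlas (m := m) (q := q) hlin) :
    Compatible (R₁.total (orbitProj hlin)) (R₂.total (orbitProj hlin)) := by
  obtain ⟨hR₁, x₁, σ₁, S₁, θ₁, s₁⟩ := h₁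
  obtain ⟨hR₂, x₂, σ₂, S₂, θ₂, s₂⟩ := h₂
  rintro ⟨z₁, v₁⟩ ⟨hz₁, -⟩ ⟨z₂, v₂⟩ ⟨hz₂, -⟩ hz
  change R₁.projTotal (z₁, v₁) = R₂.projTotal (z₂, v₂) at hz
  change z₁ ∈ R₁.source at hz₁
  change z₂ ∈ R₂.source at hz₂
  rw [s₁.projTotal_eq z₁ hz₁, s₂.projTotal_eq z₂ hz₂, eq_comm] at hz
  obtain ⟨g₀, hg₀⟩ := mk_eq_mk_iff.1 hz
  have f₁ := s₁.isFrame hR₁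
  have f₂ := s₂.isFrame hR₂
  have hg₀' : g₀ • σ₂ z₂ = σ₁ z₁ := by
    rw [← f₁.proj hz₁ v₁, ← hg₀, hlin.proj_smul, f₂.proj hz₂]
  obtain ⟨h, H, hd, hD, h1, h2, h3, h4, h5, h6, h7, h8, h9, h10⟩ := exists_transition hlin
    f₁ f₂ s₁.localDiffeo s₂.localDiffeo hz₁ hz₂ hg₀'
  refine ⟨H, hD, h5 ▸ ⟨h1, mem_univ _⟩, ?_, fun y hy => ?_, fun y hy => ?_, fun y hy => ?_⟩
  · have h11 : (H (z₁, v₁)).1 = z₂ := (h7 z₁ h1 v₁).trans h2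
    refine Prod.ext h11 (f₂.injective hz₂ ?_)
    change S₂ (z₂, (H (z₁, v₁)).2) = S₂ (z₂, v₂)
    rw [← h11, Prod.mk.eta, h11]
    exact MulAction.injective g₀ ((h10 v₁).trans hg₀.symm)
  · rw [h5] at hy
    exact ⟨h3 hy.1, mem_univ _⟩
  · rw [h6] at hy
    exact ⟨h4 hy.1, mem_univ _⟩
  · rw [h5] at hy
    obtain ⟨z, v⟩ := y
    obtain ⟨g, -, hg⟩ := h9 z hy.1
    have h12 : (H (z, v)).1 ∈ R₂.source := by
      rw [h7 z hy.1]
      exact h4 (h.map_source hy.1)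
    change R₂.projTotal (H (z, v)) = R₁.projTotal (z, v)
    rw [s₁.projTotal_eq z (h3 hy.1), ← Prod.mk.eta (p := H (z, v)), s₂.projTotal_eq _ h12]
    exact mk_eq_mk_iff.2 ⟨g, hg v⟩

theorem mem_maximalAtlas_base (h₁ : R₁ ∈ canonicalAtlas (m := m) (q := q) hlin) :
    R₁.toChartData ∈ maximalAtlas
      ((fun R => R.toChartData) '' canonicalAtlas (m := m) (q := q) hlin) := by
  refine ⟨h₁.1.base, ?_⟩
  rintro _ ⟨R, hR, rfl⟩
  exact (bundleCompatible_of_mem_canonicalAtlas h₁ hR).compatible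

theorem mem_maximalAtlas_total (h₁ : R₁ ∈ canonicalAtlas (m := m) (q := q) hlin) :
    R₁.total (orbitProj hlin) ∈ maximalAtlas
      ((fun R => R.total (orbitProj hlin)) '' canonicalAtlas (m := m) (q := q) hlin) := by
  refine ⟨h₁.1.total, ?_⟩
  rintro _ ⟨R, hR, rfl⟩
  exact compatible_total_of_mem_canonicalAtlas h₁ hR

theorem isBundleAtlas_canonicalAtlas [CompactSpace G] [∀ x : M, Finite (MulAction.stabilizer G x)]
    (hlin : ActsLinearly 𝕜 G V E) (hgen : Dense (trivialIsotropy G V E)) :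
    IsBundleAtlas 𝕜 (orbitProj hlin) (canonicalAtlas (m := m) (q := q) hlin) where
  t2_base :=
    have : ContinuousSMul G M := ContMDiffSMul.continuousSMul (I := 𝓡 q) (I' := 𝓡 m) ∞
    t2Space_orbitQuotient G M
  t2_total :=
    have : T2Space (TotalSpace V E) := t2Space_totalSpace E
    have : ContinuousSMul G (TotalSpace V E) :=
      ContMDiffSMul.continuousSMul (I := 𝓡 q) (I' := (𝓡 m).prod 𝓘(ℝ, V)) ∞
    t2Space_orbitQuotient G (TotalSpace V E)
  continuous := (FiberBundle.continuous_proj V E).quotient_map' _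
  chart R hR := hR.1
  cover y := by
    induction y using Quotient.inductionOn with
    | h x =>
      obtain ⟨R, σ, S, θ, A, hR, hs, -⟩ := exists_linear_chart (m := m) (q := q) hlin hgen x
      refine ⟨R, ⟨hR, x, σ, S, θ, hs⟩, ?_⟩
      rw [← hR.base.image]
      exact ⟨0, hs.zero_mem, by rw [hs.proj_eq 0 hs.zero_mem, hs.center]⟩
  compatible R hR R' hR' := bundleCompatible_of_mem_canonicalAtlas hR hR'

end Atlas

/-! ### Lifts of sections in a chart with linear action -/

/-- A smooth map that agrees at each point with one of finitely many linear maps agrees with one of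
them everywhere. By Baire's theorem its derivative is one of these linear maps at a dense set of
points, hence at all points, and so it is constant. -/
theorem exists_eqOn_of_forall_exists_eq {F F' ι : Type*} [NormedAddCommGroup F] [NormedSpace ℝ F]
    [CompleteSpace F] [NormedAddCommGroup F'] [NormedSpace ℝ F'] [Finite ι] (A : ι → F →L[ℝ] F')
    {B : Set F} (hB : IsOpen B) (hBc : IsPreconnected B) (h0 : 0 ∈ B) {f : F → F'}
    (hf : ContDiffOn ℝ ∞ f B) (hfA : ∀ z ∈ B, ∃ i, f z = A i z) : ∃ i, EqOn f (A i) B := by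
  have hfc : ContinuousOn (fderiv ℝ f) B := hf.continuousOn_fderiv_of_isOpen hB (by simp)
  have hclosure : B ⊆ closure (B ∩ fderiv ℝ f ⁻¹' range A) := by
    intro z hz
    rw [mem_closure_iff]
    intro W hW hzW
    have hWB : IsOpen (W ∩ B) := hW.inter hB
    have : BaireSpace ↥(W ∩ B) := hWB.baireSpace
    have : Nonempty ↥(W ∩ B) := ⟨⟨z, hzW, hz⟩⟩
    have hfW : Continuous fun w : ↥(W ∩ B) => f w :=
      (hf.continuousOn.mono inter_subset_right).domRestrict
    obtain ⟨i, ⟨w, hw⟩, hwi⟩ := nonempty_interior_of_iUnion_of_closed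
      (f := fun i => {w : ↥(W ∩ B) | f w = A i w})
      (fun i => isClosed_eq hfW ((A i).continuous.comp continuous_subtype_val))
      (eq_univ_of_forall fun w => mem_iUnion.2 (hfA w w.2.2))
    refine ⟨w, hw.1, hw.2, i, ?_⟩
    have hev : f =ᶠ[𝓝 w] A i := by
      have h1 := mem_interior_iff_mem_nhds.1 hwi
      rw [mem_nhds_subtype_iff_nhdsWithin, hWB.nhdsWithin_eq hw] at h1
      filter_upwards [h1] with v hv
      obtain ⟨v', hv', rfl⟩ := hv
      exact hv'
    rw [hev.fderiv_eq, (A i).fderiv]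
  have hrange : MapsTo (fderiv ℝ f) B (range A) := by
    intro z hz
    have hcl : IsClosed (range A) := (finite_range A).isClosed
    have h1 : (𝓝[B ∩ fderiv ℝ f ⁻¹' range A] z).NeBot :=
      mem_closure_iff_nhdsWithin_neBot.1 (hclosure hz)
    have h2 : ∀ᶠ w in 𝓝[B ∩ fderiv ℝ f ⁻¹' range A] z, fderiv ℝ f w ∈ range A := by
      filter_upwards [self_mem_nhdsWithin] with w hw
      exact hw.2
    exact hcl.mem_of_tendsto ((hfc z hz).mono_left (nhdsWithin_mono z inter_subset_left)) h2
  obtain ⟨i, hi⟩ := hrange h0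
  refine ⟨i, hB.eqOn_of_fderiv_eq hBc (hf.differentiableOn (by simp))
    (A i).differentiable.differentiableOn (fun z hz => ?_) h0 ?_⟩
  · rw [(A i).fderiv, hi]
    exact hBc.constant_of_mapsTo (finite_range A).isDiscrete hfc hrange hz h0
  · obtain ⟨j, hj⟩ := hfA 0 h0
    rw [hj, map_zero, map_zero]

/-- A smooth section of an orbibundle lifts to a smooth section of the trivial bundle, on a
neighbourhood of a fixed point `0` of a chart with linear action. A lift in other charts is carried
over by transition maps to a lift `L` that may fail to cover the identity of the base; by
rigidity it covers a single element of the group, which is then removed. -/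
theorem exists_lift_of_mem_smoothSections {𝕜 : Type*} [RCLike 𝕜] {F : Type*}
    [NormedAddCommGroup F] [NormedSpace ℝ F] [CompleteSpace F] {V : Type*} [NormedAddCommGroup V]
    [NormedSpace ℝ V] [NormedSpace 𝕜 V] {X Y : Type*} [TopologicalSpace X] [TopologicalSpace Y]
    {p : Y → X} {A : Set (BundleChartData.{u} F V X Y)} {s : X → Y} (hs : s ∈ smoothSections p A)
    {R : BundleChartData.{u} F V X Y} (hRA : R ∈ A) (hR : IsBundleChart 𝕜 p R) (h0 : 0 ∈ R.source)
    {a : R.Γ → F →L[ℝ] F} (ha : ∀ γ, R.act γ = a γ) :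
    ∃ B ⊆ R.source, IsOpen B ∧ 0 ∈ B ∧ ∃ w : F → F × V, ContDiffOn ℝ ∞ w B ∧
      ∀ z ∈ B, (w z).1 = z ∧ R.projTotal (w z) = s (R.proj z) := by
  obtain ⟨hps, -, hloc⟩ := hs
  obtain ⟨Q, hQ, Q', hQ', hxQ, hxQ', ℓ, hℓ, hℓm, hℓs⟩ := hloc (R.proj 0)
  have := hR.base.finite
  rw [← hQ.1.image] at hxQ
  obtain ⟨q₀, hq₀, hq₀x⟩ := hxQ
  obtain ⟨h, hhd, hh0, hhq, hhs, hht, hhp⟩ :=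
    hQ.2 _ ⟨R, hRA, rfl⟩ q₀ hq₀ 0 h0 hq₀x
  have hsR : s (R.proj 0) ∈ (R.total p).target := by
    change p (s (R.proj 0)) ∈ R.target
    rw [hps, ← hR.base.image]
    exact ⟨0, h0, rfl⟩
  rw [← hR.total.image] at hsR
  obtain ⟨y', hy', hy's⟩ := hsR
  obtain ⟨H, hHd, hH0, hHy, hHs, hHt, hHp⟩ := hQ'.2 _ ⟨R, hRA, rfl⟩ (ℓ q₀) (hℓm hq₀) y' hy'
    (by rw [hℓs q₀ hq₀, hq₀x, hy's])
  have hk : ContDiffOn ℝ ∞ (fun z => ℓ (h.symm z)) h.target :=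
    hℓ.comp hhd.2 fun z hz => hhs (h.map_target hz)
  have h0t : (0 : F) ∈ h.target := hhq ▸ h.map_source hh0
  have h0s : h.symm 0 = q₀ := by rw [← hhq, h.left_inv hh0]
  have hN : h.target ∩ (fun z => ℓ (h.symm z)) ⁻¹' H.source ∈ 𝓝 (0 : F) :=
    (hk.continuousOn.isOpen_inter_preimage h.open_target H.open_source).mem_nhds
      ⟨h0t, by rw [mem_preimage, h0s]; exact hH0⟩
  obtain ⟨r, hr, hrN⟩ := Metric.mem_nhds_iff.1 hN
  set B := Metric.ball (0 : F) r
  have hB0 : (0 : F) ∈ B := Metric.mem_ball_self hr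
  set L : F → F × V := fun z => H (ℓ (h.symm z))
  have hL : ContDiffOn ℝ ∞ L B := hHd.1.comp (hk.mono fun z hz => (hrN hz).1) fun z hz => (hrN hz).2
  have hBR : B ⊆ R.source := fun z hz => hht (hrN hz).1
  have hLR : ∀ z ∈ B, (L z).1 ∈ R.source := fun z hz => (hHt (H.map_source (hrN hz).2)).1
  have hLs : ∀ z ∈ B, R.projTotal (L z) = s (R.proj z) := by
    intro z hz
    have hz' : h.symm z ∈ h.source := h.map_target (hrN hz).1
    have h1 := hhp _ hz'
    rw [h.right_inv (hrN hz).1] at h1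
    have h1' : R.proj z = Q.proj (h.symm z) := h1
    rw [h1', ← hℓs _ (hhs hz')]
    exact hHp _ (hrN hz).2
  have hγ : ∀ z ∈ B, ∃ γ, (L z).1 = a γ z := by
    intro z hz
    have h1 : R.proj z = R.proj (L z).1 := by
      rw [← hR.comm _ (hLR z hz) (L z).2, Prod.mk.eta, hLs z hz, hps]
    obtain ⟨γ, hγ⟩ := (hR.base.fiber z (hBR hz) _ (hLR z hz)).1 h1
    exact ⟨γ, by rw [← hγ, ha]⟩
  obtain ⟨γ, hγ⟩ := exists_eqOn_of_forall_exists_eq a Metric.isOpen_ball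
    (convex_ball (0 : F) r).isPreconnected hB0 hL.fst hγ
  refine ⟨B, hBR, Metric.isOpen_ball, hB0, fun z => R.actTotal γ⁻¹ (L z),
    (hR.total.smooth γ⁻¹).comp hL fun z hz => ⟨hLR z hz, mem_univ _⟩, fun z hz => ⟨?_, ?_⟩⟩
  · have h1 := hR.act_fst γ⁻¹ _ (hLR z hz) (L z).2
    rw [Prod.mk.eta] at h1
    have h2 : (L z).1 = R.act γ z := (hγ hz).trans (by rw [ha])
    rw [h1, h2, ← hR.base.mul_act _ _ z (hBR hz), inv_mul_cancel, hR.base.one_act z (hBR hz)]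
  · rw [← hLs z hz]
    have hm : L z ∈ (R.total p).source := ⟨hLR z hz, mem_univ _⟩
    exact ((hR.total.fiber _ hm _ (hR.total.mapsTo γ⁻¹ hm)).2 ⟨γ⁻¹, rfl⟩).symm

/-! ### Invariant sections and sections of the orbibundle -/

section Sections

set_option linter.unusedSectionVars false

variable {𝕜 : Type*} [RCLike 𝕜] {m q : ℕ}
  {G : Type u} [Group G] [TopologicalSpace G] [ChartedSpace (EuclideanSpace ℝ (Fin q)) G]
  [LieGroup (𝓡 q) ∞ G]
  {M : Type*} [TopologicalSpace M] [ChartedSpace (EuclideanSpace ℝ (Fin m)) M]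
  [IsManifold (𝓡 m) ∞ M] [T2Space M]
  {V : Type*} [NormedAddCommGroup V] [NormedSpace ℝ V] [NormedSpace 𝕜 V] [IsScalarTower ℝ 𝕜 V]
  [FiniteDimensional 𝕜 V]
  {E : M → Type*} [TopologicalSpace (TotalSpace V E)] [∀ x, TopologicalSpace (E x)]
  [∀ x, AddCommGroup (E x)] [∀ x, Module ℝ (E x)] [∀ x, Module 𝕜 (E x)]
  [∀ x, IsScalarTower ℝ 𝕜 (E x)]
  [FiberBundle V E] [VectorBundle ℝ V E] [VectorBundle 𝕜 V E] [ContMDiffVectorBundle ∞ V E (𝓡 m)]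
  [MulAction G M] [ContMDiffSMul (𝓡 q) (𝓡 m) ∞ G M]
  [MulAction G (TotalSpace V E)] [ContMDiffSMul (𝓡 q) ((𝓡 m).prod 𝓘(ℝ, V)) ∞ G (TotalSpace V E)]

/-- A point with trivial isotropy on the fibre determines a vector over it by its orbit. By density,
continuous local sections that induce the same map of orbit spaces are equal. -/
theorem eqOn_of_mk_eq (hlin : ActsLinearly 𝕜 G V E) (hgen : Dense (trivialIsotropy G V E))
    {O : Set M} (hO : IsOpen O) {e₁ e₂ : M → TotalSpace V E} (h₁ : ContinuousOn e₁ O)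
    (h₂ : ContinuousOn e₂ O) (hp₁ : ∀ y ∈ O, (e₁ y).proj = y) (hp₂ : ∀ y ∈ O, (e₂ y).proj = y)
    (h : ∀ y ∈ O, (Quotient.mk _ (e₁ y) : MulAction.orbitRel.Quotient G (TotalSpace V E)) =
      Quotient.mk _ (e₂ y)) : EqOn e₁ e₂ O := by
  have : T2Space (TotalSpace V E) := t2Space_totalSpace E
  refine EqOn.of_subset_closure (s := O ∩ trivialIsotropy G V E) (fun y hy => ?_) h₁ h₂
    inter_subset_left (hgen.open_subset_closure_inter hO)
  obtain ⟨g, hg⟩ := mk_eq_mk_iff.1 (h y hy.1)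
  have hgy : g • y = y := by
    have h1 := congrArg TotalSpace.proj hg
    rwa [hlin.proj_smul, hp₁ y hy.1, hp₂ y hy.1] at h1
  have h2 : g • e₁ y = e₁ y := by
    have h3 : (e₁ y).proj ∈ trivialIsotropy G V E := by rw [hp₁ y hy.1]; exact hy.2
    refine h3 g ?_ (e₁ y).2
    rw [MulAction.mem_stabilizer_iff, hp₁ y hy.1, hgy]
  rw [← hg, h2]

theorem InvariantSection.contMDiff (f : InvariantSection (m := m) G V E) :
    ContMDiff (𝓡 m) ((𝓡 m).prod 𝓘(ℝ, V)) ∞ fun y => (⟨y, f.1 y⟩ : TotalSpace V E) :=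
  f.1.contMDiff_toFun

theorem injective_induced (hlin : ActsLinearly 𝕜 G V E) (hgen : Dense (trivialIsotropy G V E)) :
    Injective fun f : InvariantSection (m := m) G V E => f.induced := by
  intro f f' h
  have h1 : EqOn (fun y => (⟨y, f.1 y⟩ : TotalSpace V E)) (fun y => ⟨y, f'.1 y⟩) univ :=
    eqOn_of_mk_eq hlin hgen isOpen_univ f.contMDiff.continuous.continuousOn
      f'.contMDiff.continuous.continuousOn (fun _ _ => rfl) (fun _ _ => rfl) fun y _ =>
        congrFun h (Quotient.mk _ y)
  exact Subtype.ext (ContMDiffSection.ext fun y => TotalSpace.mk_injective y (h1 (mem_univ y)))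

variable [CompactSpace G] [∀ x : M, Finite (MulAction.stabilizer G x)]

theorem induced_mem_smoothSections (hlin : ActsLinearly 𝕜 G V E)
    (hgen : Dense (trivialIsotropy G V E)) (f : InvariantSection (m := m) G V E) :
    f.induced ∈ smoothSections (orbitProj hlin) (canonicalAtlas (m := m) (q := q) hlin) := by
  have hp : ∀ y, orbitProj hlin (f.induced y) = y := fun y => by
    induction y using Quotient.inductionOn with
    | h y => rfl
  refine ⟨hp, f.contMDiff.continuous.quotient_map' _, fun y => ?_⟩
  obtain ⟨R, hR, hy⟩ := (isBundleAtlas_canonicalAtlas (m := m) (q := q) hlin hgen).cover y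
  obtain ⟨hRc, x, σ, S, θ, hs⟩ := id hR
  have hS := hs.isFrame hRc
  refine ⟨_, mem_maximalAtlas_base hR, _, mem_maximalAtlas_total hR, hy,
    (by change orbitProj hlin _ ∈ R.target; rwa [hp]),
    fun z => (z, fiberCoord S z ⟨σ z, f.1 (σ z)⟩), ?_, fun z hz => ⟨hz, mem_univ _⟩, ?_⟩
  · intro z hz
    refine (contDiffAt_id.prodMk (hS.contDiffAt_fiberCoord contDiffAt_id ?_ hz
      (Filter.Eventually.of_forall fun _ => rfl))).contDiffWithinAt
    exact f.contMDiff.contMDiffAt.comp z (hS.smooth.contMDiffAt (hS.isOpen.mem_nhds hz))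
  · intro z hz
    change R.projTotal _ = f.induced (R.proj z)
    rw [hs.projTotal_eq z hz, hs.proj_eq z hz, hS.apply_fiberCoord hz rfl]
    rfl

/-- Locally, a smooth section of the orbibundle comes from a smooth section of `E`: a lift over a
slice is extended by the action of `G`. -/
theorem exists_local_section (hlin : ActsLinearly 𝕜 G V E) (hgen : Dense (trivialIsotropy G V E))
    {s : MulAction.orbitRel.Quotient G M → MulAction.orbitRel.Quotient G (TotalSpace V E)}
    (hs : s ∈ smoothSections (orbitProj hlin) (canonicalAtlas (m := m) (q := q) hlin)) (x : M) :
    ∃ e : M → TotalSpace V E, ∀ᶠ y in 𝓝 x,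
      ContMDiffAt (𝓡 m) ((𝓡 m).prod 𝓘(ℝ, V)) ∞ e y ∧ (e y).proj = y ∧
        Quotient.mk _ (e y) = s (Quotient.mk _ y) := by
  obtain ⟨R, σ, S, θ, a, hR, hsl, ha⟩ := exists_linear_chart (m := m) (q := q) hlin hgen x
  have hS := hsl.isFrame hR
  obtain ⟨B, hBR, hB, h0, w, hw, hws⟩ := exists_lift_of_mem_smoothSections hs
    (R := R) ⟨hR, x, σ, S, θ, hsl⟩ hR hsl.zero_mem ha
  obtain ⟨p, hp0, hp⟩ := exists_smooth_coordinates
    (hsl.localDiffeo ⟨((1 : G), (0 : EuclideanSpace ℝ (Fin (m - q)))), mem_univ _, hsl.zero_mem⟩)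
  rw [one_smul, hsl.center] at hp0 hp
  have hp2 : ContinuousAt (fun y => (p y).2) x := hp.self_of_nhds.1.continuousAt.snd
  refine ⟨fun y => (p y).1 • S (w (p y).2), ?_⟩
  filter_upwards [hp, hp2.eventually_mem (hB.mem_nhds (by rw [hp0]; exact h0))] with y hy hyB
  obtain ⟨hw1, hw2⟩ := hws _ hyB
  have hSw : S (w (p y).2) = S ((p y).2, (w (p y).2).2) := congrArg S (Prod.ext hw1 rfl)
  have hwR : (w (p y).2) ∈ R.source ×ˢ (univ : Set V) := ⟨by rw [hw1]; exact hBR hyB, mem_univ _⟩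
  refine ⟨?_, ?_, ?_⟩
  · have h1 : ContMDiffAt (𝓡 m) 𝓘(ℝ, EuclideanSpace ℝ (Fin (m - q)) × V) ∞
        (fun y => w (p y).2) y :=
      ContMDiffAt.comp y (hw.contDiffAt (hB.mem_nhds hyB)).contMDiffAt hy.1.snd
    have h2 : ContMDiffAt (𝓡 m) ((𝓡 m).prod 𝓘(ℝ, V)) ∞ (fun y => S (w (p y).2)) y :=
      ContMDiffAt.comp y
        (hS.smooth_total.contMDiffAt ((hS.isOpen.prod isOpen_univ).mem_nhds hwR)) h1
    exact (contMDiff_smul (I := 𝓡 q) (I' := (𝓡 m).prod 𝓘(ℝ, V)) (n := ∞)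
      (G := G) (M := TotalSpace V E)).contMDiffAt.comp y (hy.1.fst.prodMk h2)
  · rw [hlin.proj_smul, hSw, hS.proj (hBR hyB), hy.2]
  · calc (Quotient.mk _ ((p y).1 • S (w (p y).2)) :
          MulAction.orbitRel.Quotient G (TotalSpace V E))
        = Quotient.mk _ (S (w (p y).2)) :=
          mk_eq_mk_iff.2 ⟨(p y).1⁻¹, inv_smul_smul _ _⟩
      _ = R.projTotal (w (p y).2) := by
          rw [← Prod.mk.eta (p := w (p y).2), hsl.projTotal_eq _ hwR.1]
      _ = s (Quotient.mk _ (σ (p y).2)) := by rw [hw2, hsl.proj_eq _ (hBR hyB)]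
      _ = s (Quotient.mk _ y) := congrArg s (mk_eq_mk_iff.2 ⟨(p y).1, hy.2⟩)

theorem exists_induced_eq (hlin : ActsLinearly 𝕜 G V E) (hgen : Dense (trivialIsotropy G V E))
    {s : MulAction.orbitRel.Quotient G M → MulAction.orbitRel.Quotient G (TotalSpace V E)}
    (hs : s ∈ smoothSections (orbitProj hlin) (canonicalAtlas (m := m) (q := q) hlin)) :
    ∃ f : InvariantSection (m := m) G V E, f.induced = s := by
  -- `e y` is a local section near `y`; the global section takes the value of `e y` at `y`
  choose e he using exists_local_section hlin hgen hs
  have hp : ∀ y, (e y y).proj = y := fun y => (he y).self_of_nhds.2.1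
  have hmk : ∀ y, Quotient.mk _ (e y y) = s (Quotient.mk _ y) :=
    fun y => (he y).self_of_nhds.2.2
  -- by uniqueness, the local sections agree wherever both are defined
  have hsmooth : ContMDiff (𝓡 m) ((𝓡 m).prod 𝓘(ℝ, V)) ∞ fun y => e y y := by
    intro x
    refine (he x).self_of_nhds.1.congr_of_eventuallyEq ?_
    filter_upwards [(he x).eventually_nhds] with y hy
    obtain ⟨O, hO, hOo, hyO⟩ := eventually_nhds_iff.1 ((he y).and hy)
    exact eqOn_of_mk_eq hlin hgen hOo
      (fun z hz => (hO z hz).1.1.continuousAt.continuousWithinAt)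
      (fun z hz => (hO z hz).2.1.continuousAt.continuousWithinAt)
      (fun z hz => (hO z hz).1.2.1) (fun z hz => (hO z hz).2.2.1)
      (fun z hz => (hO z hz).1.2.2.trans (hO z hz).2.2.2.symm) hyO
  have hfe : ∀ y, ∃ v : E y, (⟨y, v⟩ : TotalSpace V E) = e y y := fun y => by
    have key : ∀ (z : M) (t : TotalSpace V E), t.proj = z → ∃ v : E z, ⟨z, v⟩ = t := by
      rintro z t rfl
      exact ⟨t.2, rfl⟩
    exact key y _ (hp y)
  choose f hf using hfe
  have hfs : ContMDiff (𝓡 m) ((𝓡 m).prod 𝓘(ℝ, V)) ∞ fun y => (⟨y, f y⟩ : TotalSpace V E) := by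
    simpa only [hf] using hsmooth
  have hmkf : ∀ y, (Quotient.mk _ (⟨y, f y⟩ : TotalSpace V E) :
      MulAction.orbitRel.Quotient G (TotalSpace V E)) = s (Quotient.mk _ y) := fun y => by
    rw [hf, hmk]
  have hinv : ∀ (g : G) (y : M), g • (⟨g⁻¹ • y, f (g⁻¹ • y)⟩ : TotalSpace V E) = ⟨y, f y⟩ := by
    intro g y
    have h1 : Continuous fun y => g • (⟨g⁻¹ • y, f (g⁻¹ • y)⟩ : TotalSpace V E) :=
      (ContMDiffSMul.contMDiff_const_smul (I := 𝓡 q) (I' := (𝓡 m).prod 𝓘(ℝ, V)) (n := ∞)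
        (M := TotalSpace V E) g).continuous.comp (hfs.continuous.comp
        (ContMDiffSMul.contMDiff_const_smul (I := 𝓡 q) (I' := 𝓡 m) (n := ∞) g⁻¹).continuous)
    refine eqOn_of_mk_eq hlin hgen isOpen_univ h1.continuousOn hfs.continuous.continuousOn
      (fun z _ => ?_) (fun z _ => rfl) (fun z _ => ?_) (mem_univ y)
    · rw [hlin.proj_smul]
      exact smul_inv_smul g z
    · refine Eq.trans ?_ ((hmkf (g⁻¹ • z)).trans ?_)
      · exact mk_eq_mk_iff.2 ⟨g⁻¹, inv_smul_smul _ _⟩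
      · rw [hmkf]
        exact congrArg s (mk_eq_mk_iff.2 ⟨g, smul_inv_smul g z⟩)
  refine ⟨⟨⟨f, hfs⟩, hinv⟩, ?_⟩
  funext y
  induction y using Quotient.inductionOn with
  | h y => exact hmkf y

end Sections

end Orbifold

theorem mainTheorem11 {𝕜 : Type*} [RCLike 𝕜] {m q : ℕ}
    -- a compact Lie group
    {G : Type u} [Group G] [TopologicalSpace G] [ChartedSpace (EuclideanSpace ℝ (Fin q)) G]
    [LieGroup (𝓡 q) ∞ G] [CompactSpace G]
    -- a smooth manifold
    {M : Type*} [TopologicalSpace M] [T2Space M] [ChartedSpace (EuclideanSpace ℝ (Fin m)) M]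
    [IsManifold (𝓡 m) ∞ M]
    -- a smooth real or complex vector bundle
    {V : Type*} [NormedAddCommGroup V] [NormedSpace ℝ V] [NormedSpace 𝕜 V] [IsScalarTower ℝ 𝕜 V]
    [FiniteDimensional 𝕜 V]
    {E : M → Type*} [TopologicalSpace (TotalSpace V E)] [∀ x, TopologicalSpace (E x)]
    [∀ x, AddCommGroup (E x)] [∀ x, Module ℝ (E x)] [∀ x, Module 𝕜 (E x)]
    [∀ x, IsScalarTower ℝ 𝕜 (E x)]
    [FiberBundle V E] [VectorBundle ℝ V E] [VectorBundle 𝕜 V E] [ContMDiffVectorBundle ∞ V E (𝓡 m)]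
    -- a smooth action by vector bundle isomorphisms, with finite isotropy groups
    [MulAction G M] [ContMDiffSMul (𝓡 q) (𝓡 m) ∞ G M]
    [MulAction G (TotalSpace V E)] [ContMDiffSMul (𝓡 q) ((𝓡 m).prod 𝓘(ℝ, V)) ∞ G (TotalSpace V E)]
    (hlin : Orbifold.ActsLinearly 𝕜 G V E)
    (hfin : ∀ x : M, Finite (MulAction.stabilizer G x))
    -- generic isotropy groups act trivially on the fibre
    (hgen : Dense {x : M | ∀ g ∈ MulAction.stabilizer G x, ∀ v : E x,
      g • (⟨x, v⟩ : TotalSpace V E) = ⟨x, v⟩}) :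
    Orbifold.IsBundleAtlas 𝕜 (Orbifold.orbitProj hlin)
      (Orbifold.canonicalAtlas (m := m) (q := q) hlin) ∧
    Set.BijOn (fun f : Orbifold.InvariantSection (m := m) G V E => f.induced) Set.univ
      (Orbifold.smoothSections (Orbifold.orbitProj hlin)
        (Orbifold.canonicalAtlas (m := m) (q := q) hlin)) := by
  have : ∀ x : M, Finite (MulAction.stabilizer G x) := hfin
  exact ⟨Orbifold.isBundleAtlas_canonicalAtlas hlin hgen,
    fun f _ => Orbifold.induced_mem_smoothSections hlin hgen f,
    (Orbifold.injective_induced hlin hgen).injOn, fun s hs => by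
      obtain ⟨f, hf⟩ := Orbifold.exists_induced_eq hlin hgen hs
      exact ⟨f, Set.mem_univ _, hf⟩⟩
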